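/- A graph is a set with a symmetric irreflexive relation $\sim$. A map $\varpi:\Phi\to\Psi$ between graphs is a covering if, for every vertex $p$ of $\Phi$, it induces a bijection from the set of neighbours of $p$ onto the set of neighbours of $\varpi(p)$. If $\Phi$ is a $3$-regular graph, $\hat\Phi$ denotes the graph obtained by replacing each vertex of $\Phi$ by a triangle: its vertices are the ordered pairs $(p,q)$ with $p\sim q$ in $\Phi$, and, if $q,r,s$ are the neighbours of $p$, the neighbours of $(p,q)$ are $(q,p)$, $(p,r)$ and $(p,s)$. An automorphism $\sigma$ of $\Phi$ induces the automorphism $\hat\sigma:(p,q)\mapsto(\sigma p,\sigma q)$ of $\hat\Phi$. Let $\Gamma_0$ be the complete graph on four vertices $a,b,c,d$ and $\Gamma_{n+1}=\hat\Gamma_n$ for $n\ge 0$. By iterating $\sigma\mapsto\hat\sigma$, the group $\mathfrak S(a,b,c,d)$ of permutations of $\{a,b,c,d\}$ acts on $\Gamma_n$ by graph automorphisms, hence, by composition, on the set of coverings from any graph to $\Gamma_n$. Let $\Gamma$ be the Pascal graph: in Pascal's triangle erase the even binomial coefficients and join each remaining position to those of its six nearest neighbours that remain; take two copies of the resulting graph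 and join their apexes $p_0$ and $p_0^\vee$ by an edge. Let $q_0,r_0$ (resp. $q_0^\vee,r_0^\vee$) be the left and right neighbours of $p_0$ (resp. $p_0^\vee$) in its triangle. Then: (i) For all integers $m\ge n\ge 0$ there exist coverings $\Gamma_m\to\Gamma_n$, and $\mathfrak S(a,b,c,d)$ acts simply transitively on the set of these coverings. (ii) For every integer $n\ge 0$ there exist coverings $\Gamma\to\Gamma_n$, and $\mathfrak S(a,b,c,d)$ acts freely on the set of these coverings. This action has exactly two orbits: for every covering $\kappa:\Gamma_n\to\Gamma_0$, they are the (distinct) sets of coverings $\varpi:\Gamma\to\Gamma_n$ such that $\kappa(\varpi(q_0))=\kappa(\varpi(q_0^\vee))$ and such that $\kappa(\varpi(q_0))=\kappa(\varpi(r_0^\vee))$, respectively. (iii) For every integer $n\ge 0$, let $\Delta$ be the operator $\Delta\varphi(p)=\sum_{q\sim p}\varphi(q)$ on the space $\ell^2(\Gamma_n)$ of complex functions on the vertices of $\Gamma_n$, let $f=X^2-X-3$ and let $f^p$ be its $p$-th iterate under composition ($f^0=X$). The characteristic polynomial of $\Delta$ is $$(X-3)(X+1)^3\prod_{p=0}^{n-1}\bigl(f^p(X)-2\bigr)^3\bigl(f^p(X)\bigr)^{2\cdot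 3^{\,n-1-p}}\bigl(f^p(X)+2\bigr)^{1+2\cdot 3^{\,n-1-p}}.$$ -/

import Mathlib

open Polynomial

namespace PascalGraph

/-- A map between (simple) graphs is a covering if, for every vertex `p`, it induces a bijection
from the neighbours of `p` onto the neighbours of the image of `p`. -/
def IsCovering {V W : Type} (G : SimpleGraph V) (H : SimpleGraph W) (w : V → W) : Prop :=
  ∀ p : V, Set.BijOn w (G.neighborSet p) (H.neighborSet (w p))

/-- The set of coverings `G → H`. -/
def Covering {V W : Type} (G : SimpleGraph V) (H : SimpleGraph W) : Type :=
  {w : V → W // IsCovering G H w}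

/-- The graph obtained by replacing each vertex by a triangle: its vertices are the ordered pairs
`(p, q)` with `p ∼ q`, and `(p, q)` is joined to `(q, p)` and to the `(p, r)` with `r ≠ q`. -/
def hat {V : Type} (G : SimpleGraph V) : SimpleGraph G.Dart where
  Adj d e := e = d.symm ∨ (d.fst = e.fst ∧ d ≠ e)
  symm := ⟨by
    rintro d e (rfl | ⟨h, h'⟩)
    · exact Or.inl (by simp)
    · exact Or.inr ⟨h.symm, h'.symm⟩⟩
  loopless := ⟨by
    rintro d (h | ⟨_, h⟩)
    · exact d.symm_ne h.symm
    · exact h rfl⟩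

/-- The graphs `Γ_n` together with their vertex sets: `Γ_0` is the complete graph on four
vertices and `Γ_{n+1}` is obtained from `Γ_n` by replacing each vertex by a triangle. -/
def tower : ℕ → (V : Type) × SimpleGraph V
  | 0 => ⟨Fin 4, ⊤⟩
  | n + 1 => ⟨(tower n).2.Dart, hat (tower n).2⟩

/-- The vertex set of `Γ_n`. -/
def Vert (n : ℕ) : Type := (tower n).1

/-- The graph `Γ_n`. -/
def Gam (n : ℕ) : SimpleGraph (Vert n) := (tower n).2

theorem finite_vert : ∀ n : ℕ, Finite (Vert n)
  | 0 => inferInstanceAs (Finite (Fin 4))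
  | n + 1 => by
    have := finite_vert n
    exact Finite.of_injective (fun d : (Gam n).Dart => d.toProd)
      (fun _ _ h => SimpleGraph.Dart.ext _ _ h)

noncomputable instance (n : ℕ) : Fintype (Vert n) :=
  haveI := finite_vert n
  Fintype.ofFinite _

noncomputable instance (n : ℕ) : DecidableRel (Gam n).Adj := Classical.decRel _

/-- The automorphism `(p, q) ↦ (σ p, σ q)` of `hat G` induced by an automorphism `σ` of `G`. -/
def hatAut {V : Type} (G : SimpleGraph V) : (G ≃g G) →* (hat G ≃g hat G) where
  toFun s :=
    { toFun := fun d => s.toHom.mapDart d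
      invFun := fun d => s.symm.toHom.mapDart d
      left_inv := fun d => by ext <;> simp
      right_inv := fun d => by ext <;> simp
      map_rel_iff' := by
        intro d e
        simp [hat, SimpleGraph.Dart.ext_iff, Prod.ext_iff] }
  map_one' := rfl
  map_mul' _ _ := rfl

/-- The natural homomorphism from the group of permutations of the four vertices of `Γ_0` to the
group of automorphisms of `Γ_n`. -/
def permAut : (n : ℕ) → Equiv.Perm (Fin 4) →* (Gam n ≃g Gam n)
  | 0 =>
    { toFun := fun s =>
        { toEquiv := s
          map_rel_iff' := fun {_ _} => not_congr s.injective.eq_iff }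
      map_one' := rfl
      map_mul' := fun _ _ => rfl }
  | n + 1 => (hatAut (Gam n)).comp (permAut n)

/-- Permutations of the vertices of `Γ_0` act on the coverings `G → Γ_n` by composition with
the induced automorphisms of `Γ_n`. -/
instance {V : Type} (G : SimpleGraph V) (n : ℕ) :
    MulAction (Equiv.Perm (Fin 4)) (Covering G (Gam n)) where
  smul s w := ⟨fun p => permAut n s (w.1 p), fun p => by
    refine Set.BijOn.comp (t := (Gam n).neighborSet (w.1 p)) ?_ (w.2 p)
    refine ⟨fun q hq => ?_, (permAut n s).injective.injOn, fun q hq => ?_⟩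
    · exact (permAut n s).map_adj_iff.2 hq
    · refine ⟨(permAut n s).symm q, ?_, (permAut n s).apply_symm_apply q⟩
      rw [SimpleGraph.mem_neighborSet] at hq ⊢
      rw [← (permAut n s).map_adj_iff, (permAut n s).apply_symm_apply]
      exact hq⟩
  one_smul w := Subtype.ext (funext fun p => by
    change permAut n 1 (w.1 p) = w.1 p
    rw [map_one]; rfl)
  mul_smul s t w := Subtype.ext (funext fun p => by
    change permAut n (s * t) (w.1 p) = permAut n s (permAut n t (w.1 p))
    rw [map_mul]; rfl)

/-- The operator `Δ`, sum over the neighbours, on the space of complex functions on the vertices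
of a finite graph (which is the whole of `ℓ²` since the graph is finite). -/
def Delta {V : Type} [Fintype V] (G : SimpleGraph V) [DecidableRel G.Adj] :
    (V → ℂ) →ₗ[ℂ] (V → ℂ) where
  toFun u p := ∑ q ∈ G.neighborFinset p, u q
  map_add' u v := by
    ext p
    simp [Finset.sum_add_distrib]
  map_smul' c u := by
    ext p
    simp [Finset.mul_sum]

/-- The polynomial `f = X² - X - 3`. -/
noncomputable def f : ℂ[X] := X ^ 2 - X - 3

/-- The `p`-th iterate `f ∘ ⋯ ∘ f` of `f`, as a polynomial (it is `X` when `p = 0`). -/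
noncomputable def fIter (p : ℕ) : ℂ[X] := f.comp^[p] X

/-- The positions `(n, k)` in Pascal's triangle (row `n`, column `k`) whose binomial coefficient
is odd. -/
def TriVert : Type := {x : ℕ × ℕ // Odd (Nat.choose x.1 x.2)}

/-- Pascal's triangle with the even coefficients erased, each remaining position being joined to
the remaining ones among its nearest neighbours: those of `(n, k)` are `(n, k ± 1)`, `(n + 1, k)`,
`(n + 1, k + 1)`, `(n - 1, k)`, `(n - 1, k - 1)`. -/
def tri : SimpleGraph TriVert :=
  SimpleGraph.fromRel fun x y =>
    (y.1.1 = x.1.1 ∧ y.1.2 = x.1.2 + 1) ∨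
    (y.1.1 = x.1.1 + 1 ∧ y.1.2 = x.1.2) ∨
    (y.1.1 = x.1.1 + 1 ∧ y.1.2 = x.1.2 + 1)

/-- The apex of the triangle. -/
def apex : TriVert := ⟨(0, 0), by decide⟩

/-- The left neighbour of the apex. -/
def leftNb : TriVert := ⟨(1, 0), by decide⟩

/-- The right neighbour of the apex. -/
def rightNb : TriVert := ⟨(1, 1), by decide⟩

/-- The Pascal graph `Γ`: two copies of the triangle, joined by an edge between their apexes. -/
def pascal : SimpleGraph (Bool × TriVert) where
  Adj x y := (x.1 = y.1 ∧ tri.Adj x.2 y.2) ∨ (x.1 ≠ y.1 ∧ x.2 = apex ∧ y.2 = apex)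
  symm := ⟨by
    rintro x y (⟨h, h'⟩ | ⟨h, h1, h2⟩)
    · exact Or.inl ⟨h.symm, h'.symm⟩
    · exact Or.inr ⟨h.symm, h2, h1⟩⟩
  loopless := ⟨by
    rintro x (⟨_, h⟩ | ⟨h, _⟩)
    · exact tri.loopless.irrefl _ h
    · exact h rfl⟩

/-- For a covering `κ : Γ_n → Γ_0` and a neighbour `x` of the apex, the set of the coverings
`w : Γ → Γ_n` such that `κ ∘ w` takes the same value at the left neighbour of the apex in the
first triangle and at the point `x` of the second triangle. -/
def agreeSet (n : ℕ) (κ : Covering (Gam n) (Gam 0)) (x : TriVert) :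
    Set (Covering pascal (Gam n)) :=
  {w | κ.1 (w.1 (false, leftNb)) = κ.1 (w.1 (true, x))}

end PascalGraph

namespace PascalGraph

/-! ### Coverings and the replacement of vertices by triangles; part (i). -/

section

variable {V W : Type}

/-- Every vertex has a neighbour outside of any given pair of vertices, i.e. every vertex has at
least three neighbours. -/
def ThreeNbrs (G : SimpleGraph V) : Prop := ∀ p q r : V, ∃ s, G.Adj p s ∧ s ≠ q ∧ s ≠ r

theorem ThreeNbrs.exists_adj {G : SimpleGraph V} (hG : ThreeNbrs G) (p : V) : ∃ q, G.Adj p q :=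
  let ⟨s, hs, _⟩ := hG p p p
  ⟨s, hs⟩

theorem hat_adj_symm {G : SimpleGraph V} (d : G.Dart) : (hat G).Adj d d.symm := Or.inl rfl

theorem hat_adj_of_fst {G : SimpleGraph V} {d e : G.Dart} (h : d.fst = e.fst) (h' : d ≠ e) :
    (hat G).Adj d e := Or.inr ⟨h, h'⟩

theorem hat_adj_mk {G : SimpleGraph V} {p q r : V} (hq : G.Adj p q) (hr : G.Adj p r)
    (h : q ≠ r) : (hat G).Adj ⟨(p, q), hq⟩ ⟨(p, r), hr⟩ :=
  hat_adj_of_fst rfl fun h' => h (congrArg (fun d : G.Dart => d.snd) h')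

theorem ThreeNbrs.hat {G : SimpleGraph V} (hG : ThreeNbrs G) : ThreeNbrs (hat G) := by
  rintro ⟨⟨p, q⟩, hq⟩ x y
  change G.Adj p q at hq
  obtain ⟨r, hr, hrq, -⟩ := hG p q q
  obtain ⟨s, hs, hsq, hsr⟩ := hG p q r
  have h1 := hat_adj_symm (G := G) ⟨(p, q), hq⟩
  have h2 := hat_adj_mk hq hr hrq.symm
  have h3 := hat_adj_mk hq hs hsq.symm
  have h4 := (hat_adj_mk hr hs hsr.symm).ne
  have h5 : (⟨(p, q), hq⟩ : G.Dart).symm ≠ ⟨(p, r), hr⟩ :=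
    fun h => hq.ne (congrArg (fun d : G.Dart => d.fst) h).symm
  have h6 : (⟨(p, q), hq⟩ : G.Dart).symm ≠ ⟨(p, s), hs⟩ :=
    fun h => hq.ne (congrArg (fun d : G.Dart => d.fst) h).symm
  grind

theorem threeNbrs_gam : ∀ n, ThreeNbrs (Gam n)
  | 0 => by
    have : ∀ p q r : Fin 4, ∃ s, p ≠ s ∧ s ≠ q ∧ s ≠ r := by decide
    exact this
  | n + 1 => (threeNbrs_gam n).hat

theorem IsCovering.adj {G : SimpleGraph V} {H : SimpleGraph W} {w : V → W} (hw : IsCovering G H w)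
    {p q : V} (h : G.Adj p q) : H.Adj (w p) (w q) :=
  (hw p).mapsTo h

theorem IsCovering.exists_adj {G : SimpleGraph V} {H : SimpleGraph W} {w : V → W}
    (hw : IsCovering G H w) {p : V} {t : W} (h : H.Adj (w p) t) : ∃ q, G.Adj p q ∧ w q = t :=
  (hw p).surjOn h

theorem IsCovering.comp {U : Type} {G : SimpleGraph U} {H : SimpleGraph V} {K : SimpleGraph W}
    {v : V → W} {w : U → V} (hv : IsCovering H K v) (hw : IsCovering G H w) :
    IsCovering G K (v ∘ w) :=
  fun p => (hv (w p)).comp (hw p)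

theorem isCovering_iso {G : SimpleGraph V} {H : SimpleGraph W} (e : G ≃g H) :
    IsCovering G H e := fun p =>
  ⟨fun _ hq => e.map_adj_iff.2 hq, e.injective.injOn, fun q hq =>
    ⟨e.symm q, by
      rw [SimpleGraph.mem_neighborSet, ← e.map_adj_iff, e.apply_symm_apply]; exact hq,
      e.apply_symm_apply q⟩⟩

/-- An edge between a dart and its reverse lies in no triangle, so the triangles of `hat H` are
inside the fibres of the origin map. This is how a covering recognises these fibres. -/
theorem fst_eq_of_hat_triangle {H : SimpleGraph W} {x y z : H.Dart} (hxy : (hat H).Adj x y)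
    (hyz : (hat H).Adj y z) (hxz : (hat H).Adj x z) : x.fst = y.fst := by
  rcases hxy with rfl | ⟨h, -⟩
  · rcases hyz with rfl | ⟨h1, h2⟩
    · rcases hxz with h | ⟨h1, h2⟩
      · exact absurd ((SimpleGraph.Dart.symm_symm x).symm.trans h) x.symm_ne.symm
      · simp at h2
    · rcases hxz with h | ⟨h3, h4⟩
      · exact absurd h.symm h2
      · have := x.adj.ne
        simp_all
  · exact h

/-- A covering `G → H` induces a covering of the graphs where vertices are replaced by
triangles. -/
def hatCovering {G : SimpleGraph V} {H : SimpleGraph W} (w : Covering G H) :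
    Covering (hat G) (hat H) :=
  ⟨fun d => ⟨(w.1 d.fst, w.1 d.snd), w.2.adj d.adj⟩, by
    rintro ⟨⟨p, q⟩, hpq⟩
    change G.Adj p q at hpq
    refine ⟨?_, ?_, ?_⟩
    · rintro _ (rfl | ⟨h, h'⟩)
      · exact Or.inl rfl
      · rename_i e
        obtain ⟨⟨p', r⟩, hr⟩ := e
        obtain rfl : p = p' := h
        refine hat_adj_mk (w.2.adj hpq) (w.2.adj hr) fun h => h' ?_
        obtain rfl := (w.2 p).injOn hpq hr h
        rfl
    · rintro _ (rfl | ⟨h, h'⟩) _ (rfl | ⟨h1, h1'⟩) he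
      · rfl
      · exact absurd (congrArg (fun d : H.Dart => d.fst) he) (by
          simpa [← h1] using (w.2.adj hpq).ne')
      · exact absurd (congrArg (fun d : H.Dart => d.fst) he) (by
          simpa [← h] using (w.2.adj hpq).ne)
      · rename_i d e
        obtain ⟨⟨p', r⟩, hr⟩ := d
        obtain ⟨⟨p'', s⟩, hs⟩ := e
        obtain rfl : p = p' := h
        obtain rfl : p = p'' := h1
        obtain rfl := (w.2 p).injOn hr hs (congrArg (fun d : H.Dart => d.snd) he)
        rfl
    · rintro _ (rfl | ⟨h, h'⟩)
      · exact ⟨_, hat_adj_symm _, rfl⟩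
      · rename_i e
        obtain ⟨⟨p', r⟩, hr⟩ := e
        obtain rfl : w.1 p = p' := h
        obtain ⟨s, hs, rfl⟩ := w.2.exists_adj hr
        refine ⟨⟨(p, s), hs⟩, hat_adj_mk hpq hs ?_, rfl⟩
        rintro rfl
        exact h' rfl⟩

theorem hatCovering_injective {G : SimpleGraph V} {H : SimpleGraph W} (hG : ThreeNbrs G) :
    Function.Injective (hatCovering : Covering G H → Covering (hat G) (hat H)) := by
  intro w w' h
  refine Subtype.ext (funext fun p => ?_)
  obtain ⟨q, hq⟩ := hG.exists_adj p
  have := congrFun (congrArg Subtype.val h) ⟨(p, q), hq⟩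
  exact congrArg (fun d : H.Dart => d.fst) this

/-- Two distinct darts at `p` and a third one form a triangle, whose image is again a triangle. -/
theorem IsCovering.fst_eq {G : SimpleGraph V} {H : SimpleGraph W} (hG : ThreeNbrs G)
    {w : G.Dart → H.Dart} (hw : IsCovering (hat G) (hat H) w) {p q r : V} (hq : G.Adj p q)
    (hr : G.Adj p r) : (w ⟨(p, q), hq⟩).fst = (w ⟨(p, r), hr⟩).fst := by
  by_cases h : q = r
  · subst h; rfl
  obtain ⟨s, hs, hsq, hsr⟩ := hG p q r
  exact fst_eq_of_hat_triangle (hw.adj (hat_adj_mk hq hr h)) (hw.adj (hat_adj_mk hr hs hsr.symm))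
    (hw.adj (hat_adj_mk hq hs hsq.symm))

/-- Some neighbour of `d` lies over the reverse of `w d`. It cannot share its origin with `d`, since
its image would then share its origin with `w d`. -/
theorem IsCovering.map_symm {G : SimpleGraph V} {H : SimpleGraph W} (hG : ThreeNbrs G)
    {w : G.Dart → H.Dart} (hw : IsCovering (hat G) (hat H) w) (d : G.Dart) :
    w d.symm = (w d).symm := by
  obtain ⟨e, he, h⟩ := hw.exists_adj (hat_adj_symm (w d))
  rcases he with rfl | ⟨h1, h2⟩
  · exact h
  · obtain ⟨⟨p, q⟩, hq⟩ := d
    obtain ⟨⟨p', r⟩, hr⟩ := e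
    obtain rfl : p = p' := h1
    have := hw.fst_eq hG hq hr
    rw [h] at this
    exact absurd this (w _).adj.ne

theorem hatCovering_surjective {G : SimpleGraph V} {H : SimpleGraph W} (hG : ThreeNbrs G) :
    Function.Surjective (hatCovering : Covering G H → Covering (hat G) (hat H)) := by
  rintro ⟨w, hw⟩
  choose nb hnb using hG.exists_adj
  -- By the two preceding lemmas, `w` must be `(p, q) ↦ (v p, v q)`.
  set v : V → W := fun p => (w ⟨(p, nb p), hnb p⟩).fst with hv
  have hfst : ∀ {p q} (h : G.Adj p q), (w ⟨(p, q), h⟩).fst = v p := fun h =>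
    hw.fst_eq hG h (hnb _)
  have hsnd : ∀ {p q} (h : G.Adj p q), (w ⟨(p, q), h⟩).snd = v q := fun {p q} h => by
    rw [← hfst h.symm]
    have := hw.map_symm hG ⟨(p, q), h⟩
    change w ⟨(q, p), h.symm⟩ = _ at this
    rw [this]; rfl
  have hcov : IsCovering G H v := by
    intro p
    refine ⟨fun q hq => ?_, fun q hq r hr h => ?_, fun t ht => ?_⟩
    · rw [SimpleGraph.mem_neighborSet, ← hfst hq, ← hsnd hq]
      exact (w _).adj
    · by_contra hqr
      refine (hw.adj (hat_adj_mk hq hr hqr)).ne ?_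
      ext
      · exact (hfst hq).trans (hfst hr).symm
      · exact (hsnd hq).trans (h.trans (hsnd hr).symm)
    · change H.Adj (v p) t at ht
      by_cases h : w ⟨(p, nb p), hnb p⟩ = ⟨(v p, t), ht⟩
      · exact ⟨nb p, hnb p, by rw [← hsnd (hnb p), h]⟩
      · obtain ⟨e, he, h'⟩ := hw.exists_adj (hat_adj_of_fst (d := w ⟨(p, nb p), hnb p⟩)
          (e := ⟨(v p, t), ht⟩) rfl h)
        rcases he with rfl | ⟨h1, h2⟩
        · rw [hw.map_symm hG] at h'
          have h3 := congrArg (fun d : H.Dart => d.fst) h'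
          exact absurd ((hfst (hnb p)).trans h3.symm) (w _).adj.ne
        · obtain ⟨⟨p', r⟩, hr⟩ := e
          obtain rfl : p = p' := h1
          exact ⟨r, hr, by rw [← hsnd hr, h']⟩
  refine ⟨⟨v, hcov⟩, Subtype.ext (funext fun d => ?_)⟩
  obtain ⟨⟨p, q⟩, h⟩ := d
  ext
  · exact (hfst h).symm
  · exact (hsnd h).symm

/-- If `c` satisfies the covering condition at `p`, with values in a complete graph, then
`(p, q) ↦ c q` satisfies it at all `(p, q)`. -/
theorem snd_bijOn {G : SimpleGraph V} {c : V → W} {p q : V} (hpq : G.Adj p q)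
    (hc : Set.BijOn c (G.neighborSet p) ((⊤ : SimpleGraph W).neighborSet (c p))) :
    Set.BijOn (fun d : G.Dart => c d.snd) ((hat G).neighborSet ⟨(p, q), hpq⟩)
      ((⊤ : SimpleGraph W).neighborSet (c q)) := by
  refine ⟨?_, ?_, ?_⟩
  · rintro _ (rfl | ⟨h, h'⟩)
    · exact Ne.symm (hc.mapsTo hpq)
    · rename_i e
      obtain ⟨⟨p', r⟩, hr⟩ := e
      obtain rfl : p = p' := h
      intro h
      obtain rfl := hc.injOn hpq hr h
      exact h' rfl
  · rintro _ (rfl | ⟨h, h'⟩) _ (rfl | ⟨h1, h1'⟩) he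
    · rfl
    · rename_i e
      obtain ⟨⟨p', r⟩, hr⟩ := e
      obtain rfl : p = p' := h1
      exact absurd he (hc.mapsTo hr)
    · rename_i e
      obtain ⟨⟨p', r⟩, hr⟩ := e
      obtain rfl : p = p' := h
      exact absurd he.symm (hc.mapsTo hr)
    · rename_i d e
      obtain ⟨⟨p', r⟩, hr⟩ := d
      obtain ⟨⟨p'', s⟩, hs⟩ := e
      obtain rfl : p = p' := h
      obtain rfl : p = p'' := h1
      obtain rfl := hc.injOn hr hs he
      rfl
  · intro t ht
    change c q ≠ t at ht
    by_cases h : c p = t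
    · exact ⟨_, hat_adj_symm _, h⟩
    · obtain ⟨r, hr, rfl⟩ := hc.surjOn (show (⊤ : SimpleGraph W).Adj (c p) t from h)
      exact ⟨⟨(p, r), hr⟩, hat_adj_mk hpq hr fun h => ht (h ▸ rfl), rfl⟩

/-- A covering `G → K` with `K` complete induces a covering `hat G → K`. -/
def sndCovering {G : SimpleGraph V} (c : Covering G (⊤ : SimpleGraph W)) :
    Covering (hat G) (⊤ : SimpleGraph W) :=
  ⟨fun d => c.1 d.snd, fun d => snd_bijOn d.adj (c.2 d.fst)⟩

theorem sndCovering_injective {G : SimpleGraph V} (hG : ThreeNbrs G) :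
    Function.Injective
      (sndCovering : Covering G (⊤ : SimpleGraph W) → Covering (hat G) (⊤ : SimpleGraph W)) := by
  intro w w' h
  refine Subtype.ext (funext fun p => ?_)
  obtain ⟨q, hq⟩ := hG.exists_adj p
  exact congrFun (congrArg Subtype.val h) ⟨(q, p), hq.symm⟩

/-- The point is that the colour of `(p, q)` depends on `q` only. The colour of `(p', q)` differs
from those of all darts issuing from `q`, so among the neighbours of `(q, p)` only `(p, q)` can
carry it. -/
theorem sndCovering_surjective {G : SimpleGraph V} (hG : ThreeNbrs G) :
    Function.Surjective
      (sndCovering : Covering G (⊤ : SimpleGraph W) → Covering (hat G) (⊤ : SimpleGraph W)) := by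
  rintro ⟨w, hw⟩
  have hne : ∀ {p q r} (hp : G.Adj p q) (hr : G.Adj q r),
      w ⟨(p, q), hp⟩ ≠ w ⟨(q, r), hr⟩ := by
    intro p q r hp hr h
    by_cases hpr : r = p
    · subst hpr
      exact (hw.adj (hat_adj_symm (G := G) ⟨(r, q), hp⟩)) h
    · have h1 := (hw ⟨(q, p), hp.symm⟩).injOn (hat_adj_symm (G := G) ⟨(q, p), hp.symm⟩)
        (hat_adj_mk hp.symm hr (Ne.symm hpr)) h
      exact hp.ne (congrArg (fun d : G.Dart => d.fst) h1)
  have heq : ∀ {p p' q} (h : G.Adj p q) (h' : G.Adj p' q),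
      w ⟨(p, q), h⟩ = w ⟨(p', q), h'⟩ := by
    intro p p' q h h'
    by_contra hc
    obtain ⟨e, he, h1⟩ := hw.exists_adj (p := ⟨(q, p), h.symm⟩) (t := w ⟨(p', q), h'⟩)
      (hne h' h.symm).symm
    rcases he with rfl | ⟨h2, h3⟩
    · exact hc h1
    · obtain ⟨⟨q', r⟩, hr⟩ := e
      obtain rfl : q = q' := h2
      exact hne h' hr h1.symm
  choose nb hnb using hG.exists_adj
  set v : V → W := fun p => w ⟨(nb p, p), (hnb p).symm⟩ with hv
  have hwv : ∀ {p q} (h : G.Adj p q), w ⟨(p, q), h⟩ = v q := fun h => heq _ _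
  refine ⟨⟨v, fun p => ⟨fun q hq => ?_, fun q hq r hr h => ?_, fun t ht => ?_⟩⟩,
    Subtype.ext (funext fun d => (hwv d.adj).symm)⟩
  · have := hne (G.adj_symm hq) hq
    rwa [hwv (G.adj_symm hq), hwv hq] at this
  · by_contra hqr
    refine hw.adj (hat_adj_mk hq hr hqr) ?_
    rw [hwv hq, hwv hr, h]
  · change v p ≠ t at ht
    by_cases h : v (nb p) = t
    · exact ⟨nb p, hnb p, h⟩
    · obtain ⟨e, he, h1⟩ := hw.exists_adj (p := ⟨(p, nb p), hnb p⟩) (t := t) (by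
        rw [hwv]; exact h)
      rcases he with rfl | ⟨h2, h3⟩
      · exact absurd ((hwv _).symm.trans h1) ht
      · obtain ⟨⟨q', r⟩, hr⟩ := e
        obtain rfl : p = q' := h2
        exact ⟨r, hr, (hwv hr).symm.trans h1⟩

/-- A bijective map which commutes with the actions transports simple transitivity. -/
theorem simplyTransitive_of_bijective {S X Y : Type} [Group S] [MulAction S X] [MulAction S Y]
    {F : X → Y} (hF : Function.Bijective F) (hs : ∀ (s : S) x, F (s • x) = s • F x)
    (h : Nonempty X ∧ ∀ x x' : X, ∃! s : S, s • x = x') :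
    Nonempty Y ∧ ∀ y y' : Y, ∃! s : S, s • y = y' := by
  refine ⟨h.1.map F, fun y y' => ?_⟩
  obtain ⟨x, rfl⟩ := hF.2 y
  obtain ⟨x', rfl⟩ := hF.2 y'
  simpa only [← hs, hF.1.eq_iff] using h.2 x x'

/-- The map `Cov(G, Γ_n) → Cov(hat G, Γ_{n+1})`. -/
def hatGam {G : SimpleGraph V} {n : ℕ} (w : Covering G (Gam n)) : Covering (hat G) (Gam (n + 1)) :=
  hatCovering w

/-- The map `Cov(G, Γ_0) → Cov(hat G, Γ_0)`. -/
def sndGam {G : SimpleGraph V} (w : Covering G (Gam 0)) : Covering (hat G) (Gam 0) :=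
  sndCovering (W := Fin 4) w

theorem hatGam_bijective {G : SimpleGraph V} (hG : ThreeNbrs G) (n : ℕ) :
    Function.Bijective (hatGam : Covering G (Gam n) → _) :=
  ⟨hatCovering_injective hG, hatCovering_surjective hG⟩

theorem sndGam_bijective {G : SimpleGraph V} (hG : ThreeNbrs G) :
    Function.Bijective (sndGam : Covering G (Gam 0) → _) :=
  ⟨sndCovering_injective (W := Fin 4) hG, sndCovering_surjective (W := Fin 4) hG⟩

theorem hatGam_smul {G : SimpleGraph V} {n : ℕ} (s : Equiv.Perm (Fin 4))
    (w : Covering G (Gam n)) : hatGam (s • w) = s • hatGam w := rfl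

theorem sndGam_smul {G : SimpleGraph V} (s : Equiv.Perm (Fin 4)) (w : Covering G (Gam 0)) :
    sndGam (s • w) = s • sndGam w := rfl

theorem Covering.surjective_zero {G : SimpleGraph V} (w : Covering G (Gam 0)) (p : V) (t : Fin 4) :
    w.1 p = t ∨ ∃ q, G.Adj p q ∧ w.1 q = t := by
  by_cases h : w.1 p = t
  · exact Or.inl h
  · exact Or.inr (w.2.exists_adj h)

/-- A covering of a complete graph is surjective, hence here a permutation of the four vertices. -/
theorem simplyTransitive_zero_zero : Nonempty (Covering (Gam 0) (Gam 0)) ∧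
    ∀ w w' : Covering (Gam 0) (Gam 0), ∃! s : Equiv.Perm (Fin 4), s • w = w' := by
  refine ⟨⟨⟨id, isCovering_iso SimpleGraph.Iso.refl⟩⟩, fun w w' => ?_⟩
  have hb : ∀ w : Covering (Gam 0) (Gam 0), Function.Bijective (w.1 : Fin 4 → Fin 4) := fun w =>
    Finite.surjective_iff_bijective.1 fun t => by
      rcases w.surjective_zero (0 : Fin 4) t with h | ⟨q, -, h⟩
      exacts [⟨_, h⟩, ⟨_, h⟩]
  refine ⟨(Equiv.ofBijective _ (hb w)).symm.trans (Equiv.ofBijective _ (hb w')), ?_, ?_⟩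
  · exact Subtype.ext (funext fun p =>
      congrArg w'.1 ((Equiv.ofBijective _ (hb w)).symm_apply_apply p))
  · rintro s rfl
    ext t : 1
    obtain ⟨p, rfl⟩ := (hb w).2 t
    exact (congrArg (s • w).1 ((Equiv.ofBijective _ (hb w)).symm_apply_apply p)).symm

/-- The permutations of the vertices of `Γ_0` act simply transitively on the coverings
`Γ_m → Γ_n` for `m ≥ n`. -/
theorem simplyTransitive_gam : ∀ n m : ℕ, n ≤ m → Nonempty (Covering (Gam m) (Gam n)) ∧
    ∀ w w' : Covering (Gam m) (Gam n), ∃! s : Equiv.Perm (Fin 4), s • w = w'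
  | 0, 0, _ => simplyTransitive_zero_zero
  | 0, m + 1, _ => simplyTransitive_of_bijective (sndGam_bijective (threeNbrs_gam m))
      sndGam_smul (simplyTransitive_gam 0 m m.zero_le)
  | n + 1, 0, h => absurd h (by simp)
  | n + 1, m + 1, h => simplyTransitive_of_bijective (hatGam_bijective (threeNbrs_gam m) n)
      hatGam_smul (simplyTransitive_gam n m (Nat.le_of_succ_le_succ h))

end

/-! ### The characteristic polynomial of `hat G` for a 3-regular graph `G`. -/

section Charpoly

set_option linter.unusedSectionVars false

open Matrix

variable {V : Type} [Fintype V] [DecidableEq V] (G : SimpleGraph V) [DecidableRel G.Adj]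
  [Fintype G.Dart] [DecidableEq G.Dart]

/-- The permutation matrix of the reversal of darts. -/
def revMatrix : Matrix G.Dart G.Dart ℂ := of fun d e => if e = d.symm then 1 else 0

/-- The incidence matrix between darts and their origins. -/
def fstMatrix : Matrix G.Dart V ℂ := of fun d p => if d.fst = p then 1 else 0

theorem revMatrix_mul (n : Type) (A : Matrix G.Dart n ℂ) :
    revMatrix G * A = A.submatrix SimpleGraph.Dart.symm id := by
  ext d e
  simp [revMatrix, Matrix.mul_apply]

theorem revMatrix_mul_self : revMatrix G * revMatrix G = 1 := by
  rw [revMatrix_mul]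
  ext d e
  simp [revMatrix, Matrix.one_apply, eq_comm]

theorem sum_dart_eq (u : V → V → ℂ) :
    ∑ d : G.Dart, u d.fst d.snd = ∑ p, ∑ q, if G.Adj p q then u p q else 0 := by
  rw [← Fintype.sum_prod_type', ← Finset.sum_filter]
  refine Finset.sum_bij (fun d _ => d.toProd) (by simp [SimpleGraph.Dart.adj])
    (fun d _ e _ h => SimpleGraph.Dart.ext _ _ h) (fun ⟨p, q⟩ h => ?_) (fun _ _ => rfl)
  exact ⟨⟨(p, q), by simpa using h⟩, Finset.mem_univ _, rfl⟩

theorem fstMatrix_transpose_mul (hG : G.IsRegularOfDegree 3) :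
    (fstMatrix G)ᵀ * fstMatrix G = (3 : ℂ) • 1 := by
  ext p q
  have h := sum_dart_eq G (fun a _ => (if a = p then 1 else 0) *
    (if a = q then 1 else 0) : V → V → ℂ)
  simp only [Matrix.mul_apply, fstMatrix, transpose_apply, of_apply]
  rw [h]
  have h3 : ∑ x, (if G.Adj p x then (1 : ℂ) else 0) = 3 := by
    rw [Finset.sum_boole, ← G.neighborFinset_eq_filter, SimpleGraph.card_neighborFinset_eq_degree,
      hG p]
    norm_num
  by_cases hpq : p = q
  · subst hpq
    rw [Finset.sum_eq_single p (fun b _ hb => by simp [hb]) (by simp)]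
    simpa using h3
  · rw [Finset.sum_eq_zero]
    · simp [hpq]
    · intro a _
      by_cases hap : a = p
      · subst hap; simp [hpq]
      · simp [hap]

theorem fstMatrix_transpose_mul_revMatrix_mul :
    (fstMatrix G)ᵀ * (revMatrix G * fstMatrix G) = G.adjMatrix ℂ := by
  ext p q
  have h := sum_dart_eq G (fun a b => (if a = p then 1 else 0) *
    (if b = q then 1 else 0) : V → V → ℂ)
  rw [revMatrix_mul]
  simp only [Matrix.mul_apply, fstMatrix, transpose_apply, of_apply, submatrix_apply, id]
  refine h.trans ?_
  rw [Finset.sum_eq_single p (fun b _ hb => by simp [hb]) (by simp),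
    Finset.sum_eq_single q (fun b _ hb => by simp [hb]) (by simp)]
  simp [SimpleGraph.adjMatrix_apply]

/-- The product of `fstMatrix G` and its transpose detects a common origin; subtracting 1 removes
the pairs `(d, d)`. -/
theorem adjMatrix_hat [DecidableRel (hat G).Adj] :
    (hat G).adjMatrix ℂ = revMatrix G + fstMatrix G * (fstMatrix G)ᵀ - 1 := by
  ext d e
  have h1 : ((hat G).Adj d e) ↔ (e = d.symm ∨ (d.fst = e.fst ∧ d ≠ e)) := Iff.rfl
  have h3 : ∀ d : G.Dart, d ≠ d.symm := fun d => d.symm_ne.symm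
  simp only [SimpleGraph.adjMatrix_apply, h1, Matrix.sub_apply, Matrix.add_apply, Matrix.mul_apply,
    revMatrix, fstMatrix, of_apply, transpose_apply, Matrix.one_apply]
  simp only [mul_ite, mul_one, mul_zero, Finset.sum_ite_eq, Finset.mem_univ, if_true]
  by_cases he : e = d.symm
  · subst he
    simp [h3 d]
  · by_cases hd : d = e
    · subst hd; simp [h3 d]
    · by_cases hf : d.fst = e.fst
      · simp [he, hd, hf]
      · simp [he, hd, hf]

/-- Orient the edges by a linear order on `V`. Conjugation by the diagonal matrix of signs of the
darts changes `R` to `-R`, so `y + R` and `y - R` have the same determinant, and their product is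
`y² - 1`. -/
theorem det_add_revMatrix_sq (y : ℂ) :
    (y • 1 + revMatrix G).det ^ 2 = (y ^ 2 - 1) ^ Fintype.card G.Dart := by
  obtain ⟨o⟩ : Nonempty (LinearOrder V) := ⟨IsWellOrder.linearOrder WellOrderingRel⟩
  set E : Matrix G.Dart G.Dart ℂ := diagonal fun d => if o.lt d.fst d.snd then 1 else -1 with hE
  have hEE : E * E = 1 := by
    rw [hE, diagonal_mul_diagonal, ← diagonal_one]
    congr 1
    ext d
    split_ifs <;> simp
  have hES : E * revMatrix G * E = - revMatrix G := by
    ext d e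
    rw [hE, mul_diagonal, diagonal_mul]
    simp only [revMatrix, of_apply, Matrix.neg_apply]
    by_cases h : e = d.symm
    · subst h
      have hne := d.adj.ne
      rcases lt_trichotomy d.fst d.snd with h1 | h1 | h1
      · have h2 := lt_asymm h1
        simp [h1, h2]
      · exact absurd h1 hne
      · have h2 := lt_asymm h1
        simp [h1, h2]
    · simp [h]
  have hconj : (y • 1 + revMatrix G).det = (y • 1 - revMatrix G).det := by
    have h1 : E * (y • 1 + revMatrix G) * E = y • 1 - revMatrix G := by
      rw [mul_add, add_mul, hES, mul_smul_comm, smul_mul_assoc, mul_one, hEE, sub_eq_add_neg]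
    have h2 : E.det * E.det = 1 := by rw [← det_mul, hEE, det_one]
    rw [← h1, det_mul, det_mul, mul_right_comm, h2, one_mul]
  have hmul : (y • 1 + revMatrix G) * (y • 1 - revMatrix G) = (y ^ 2 - 1) • 1 := by
    rw [add_mul, mul_sub, mul_sub, revMatrix_mul_self]
    simp only [smul_mul_assoc, mul_smul_comm, one_mul, mul_one, smul_smul, sub_smul, one_smul, sq]
    abel
  rw [sq]
  nth_rewrite 2 [hconj]
  rw [← det_mul, hmul, det_smul, det_one, mul_one]

/-- With `z = x² + 2x = (x + 1)² - 1`, one has `(x + 1 + R)(x - Â) = z - (x + 1 + R) S Sᵀ`.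
Exchanging the factors replaces the last term by `Sᵀ (x + 1 + R) S = 3(x + 1) + A`, and `z - 3(x +
1) = x² - x - 3` is the origin of `f`. -/
theorem det_add_revMatrix_mul_eval_charpoly (hG : G.IsRegularOfDegree 3)
    [DecidableRel (hat G).Adj] (x : ℂ) (hx : x ^ 2 + 2 * x ≠ 0) :
    ((x + 1) • 1 + revMatrix G).det * ((hat G).adjMatrix ℂ).charpoly.eval x *
        (x ^ 2 + 2 * x) ^ Fintype.card V =
      (x ^ 2 + 2 * x) ^ Fintype.card G.Dart * (G.adjMatrix ℂ).charpoly.eval (x ^ 2 - x - 3) := by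
  set z := x ^ 2 + 2 * x with hz
  rw [eval_charpoly, eval_charpoly, ← det_mul]
  have h1 : ((x + 1) • 1 + revMatrix G) * (scalar G.Dart x - (hat G).adjMatrix ℂ) =
      z • (1 - (z⁻¹ • (((x + 1) • 1 + revMatrix G) * fstMatrix G)) * (fstMatrix G)ᵀ) := by
    have h2 : scalar G.Dart x - (hat G).adjMatrix ℂ =
        ((x + 1) • 1 - revMatrix G) - fstMatrix G * (fstMatrix G)ᵀ := by
      rw [adjMatrix_hat, scalar_apply, ← smul_one_eq_diagonal, add_smul, one_smul]
      abel
    have h3 : ((x + 1) • 1 + revMatrix G) * ((x + 1) • 1 - revMatrix G) = z • 1 := by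
      rw [add_mul, mul_sub, mul_sub, revMatrix_mul_self]
      simp only [smul_mul_assoc, mul_smul_comm, one_mul, mul_one, smul_smul]
      have : z = (x + 1) * (x + 1) - 1 := by rw [hz]; ring
      rw [this, sub_smul, one_smul]
      abel
    rw [h2, Matrix.mul_sub, h3, smul_sub, Matrix.smul_mul, smul_smul, mul_inv_cancel₀ hx, one_smul,
      Matrix.mul_assoc]
  have h4 : (fstMatrix G)ᵀ * (z⁻¹ • (((x + 1) • 1 + revMatrix G) * fstMatrix G)) =
      z⁻¹ • ((3 * (x + 1)) • 1 + G.adjMatrix ℂ) := by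
    rw [Matrix.mul_smul, Matrix.add_mul, Matrix.mul_add, fstMatrix_transpose_mul_revMatrix_mul,
      Matrix.smul_mul, Matrix.one_mul, Matrix.mul_smul, fstMatrix_transpose_mul G hG, smul_smul,
      mul_comm 3]
  have h5 : scalar V (x ^ 2 - x - 3) - G.adjMatrix ℂ =
      z • (1 - z⁻¹ • ((3 * (x + 1)) • 1 + G.adjMatrix ℂ)) := by
    rw [smul_sub, smul_smul, mul_inv_cancel₀ hx, one_smul, scalar_apply, ← smul_one_eq_diagonal,
      ← sub_sub, ← sub_smul]
    congr 2
    rw [hz]; ring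
  rw [h1, det_smul, det_one_sub_mul_comm, h4, h5, det_smul]
  ring

theorem card_dart_of_regular {k : ℕ} (hG : G.IsRegularOfDegree k) :
    Fintype.card G.Dart = k * Fintype.card V := by
  have h := G.dart_card_eq_sum_degrees
  simp only [hG.degree_eq, Finset.sum_const, smul_eq_mul, Finset.card_univ] at h
  rw [mul_comm k, ← h]
  convert rfl

theorem charpoly_hat_sq (hG : G.IsRegularOfDegree 3) [DecidableRel (hat G).Adj] :
    ((hat G).adjMatrix ℂ).charpoly ^ 2 =
      (X * (X + 2)) ^ Fintype.card V * ((G.adjMatrix ℂ).charpoly.comp f) ^ 2 := by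
  have hne : (X * (X + 2) : ℂ[X]) ≠ 0 :=
    mul_ne_zero X_ne_zero (X_add_C_ne_zero (2 : ℂ))
  -- The extra factor makes the identity trivial at 0 and -2, where the determinant relation is
  -- unavailable.
  refine mul_left_cancel₀ hne (Polynomial.funext fun x => ?_)
  simp only [eval_mul, eval_pow, eval_add, eval_X, eval_ofNat, eval_comp, f, eval_sub]
  by_cases hx : x ^ 2 + 2 * x = 0
  · have : x * (x + 2) = 0 := by rw [← hx]; ring
    simp [this]
  congr 1
  have h1 := det_add_revMatrix_sq G (x + 1)
  have h2 := det_add_revMatrix_mul_eval_charpoly G hG x hx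
  rw [card_dart_of_regular G hG] at h1 h2
  rw [show x * (x + 2) = x ^ 2 + 2 * x by ring]
  rw [show (x + 1) ^ 2 - 1 = x ^ 2 + 2 * x by ring] at h1
  generalize x ^ 2 + 2 * x = z at *
  generalize ((hat G).adjMatrix ℂ).charpoly.eval x = a at *
  generalize (G.adjMatrix ℂ).charpoly.eval (x ^ 2 - x - 3) = b at *
  generalize ((x + 1) • 1 + revMatrix G).det = c at *
  generalize Fintype.card V = N at *
  have hz : z ^ N ≠ 0 := pow_ne_zero _ hx
  -- Squaring the relation `h2` brings in `c² = z ^ (3N)` from `h1`, hence `z ^ (5N)` on the left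
  -- and `z ^ (6N)` on the right.
  refine mul_left_cancel₀ (pow_ne_zero 5 hz) ?_
  have h3 : z ^ (3 * N) = (z ^ N) ^ 3 := by rw [mul_comm, pow_mul]
  rw [h3] at h1 h2
  calc (z ^ N) ^ 5 * a ^ 2 = (c * a * z ^ N) ^ 2 := by rw [mul_pow, mul_pow, h1]; ring
    _ = _ := by rw [h2]; ring

/-- Of the two square roots of the preceding identity, only one is monic. -/
theorem charpoly_hat (hG : G.IsRegularOfDegree 3) [DecidableRel (hat G).Adj] {k : ℕ}
    (hk : Fintype.card V = 2 * k) :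
    ((hat G).adjMatrix ℂ).charpoly =
      (X * (X + 2)) ^ k * (G.adjMatrix ℂ).charpoly.comp f := by
  have h := charpoly_hat_sq G hG
  rw [hk, mul_comm 2, pow_mul, ← mul_pow] at h
  have hf : f.natDegree = 2 ∧ f.Monic := by
    rw [f]
    constructor
    · compute_degree!
    · monicity!
  have hm : (((X * (X + 2)) ^ k * (G.adjMatrix ℂ).charpoly.comp f) : ℂ[X]).Monic := by
    refine Monic.mul (Monic.pow (monic_X.mul (monic_X_add_C 2)) _) ?_
    exact (Matrix.charpoly_monic _).comp hf.2 (by rw [hf.1]; norm_num)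
  rcases sq_eq_sq_iff_eq_or_eq_neg.1 h with h | h
  · exact h
  · have h1 := congrArg leadingCoeff h
    rw [leadingCoeff_neg, hm.leadingCoeff, (Matrix.charpoly_monic _).leadingCoeff] at h1
    norm_num at h1

end Charpoly

/-! ### The spectrum of `Γ_n`; part (iii). -/

theorem IsCovering.degree_eq {V W : Type} {G : SimpleGraph V} {H : SimpleGraph W} [Fintype V]
    [Fintype W] [DecidableRel G.Adj] [DecidableRel H.Adj] {w : V → W} (hw : IsCovering G H w)
    (p : V) : G.degree p = H.degree (w p) := by
  rw [← G.card_neighborSet_eq_degree, ← H.card_neighborSet_eq_degree]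
  exact Fintype.card_congr (hw p).equiv

theorem isRegularOfDegree_gam (n : ℕ) : (Gam n).IsRegularOfDegree 3 := by
  intro p
  obtain ⟨⟨w, hw⟩⟩ := (simplyTransitive_gam 0 n n.zero_le).1
  rw [hw.degree_eq p]
  -- Arbitrary instances are needed: those carried by `Vert 0` come from choice.
  have h : ∀ (i : Fintype (Fin 4)) (j : DecidableRel (⊤ : SimpleGraph (Fin 4)).Adj) (q : Fin 4),
      (⊤ : SimpleGraph (Fin 4)).degree q = 3 := fun i j q => by
    obtain rfl := Subsingleton.elim i (Fin.fintype 4)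
    obtain rfl := Subsingleton.elim j (fun _ _ => instDecidableNot)
    exact (SimpleGraph.complete_graph_degree q).trans (by simp)
  exact h _ _ _

theorem card_vert (n : ℕ) : Fintype.card (Vert n) = 4 * 3 ^ n := by
  induction n with
  | zero =>
    rw [pow_zero, mul_one, ← Fintype.card_fin 4]
    exact Fintype.card_congr (Equiv.refl (Fin 4))
  | succ n ih =>
    classical
    have h := card_dart_of_regular (Gam n) (isRegularOfDegree_gam n)
    rw [ih] at h
    rw [pow_succ, mul_comm (3 ^ n), mul_left_comm, ← h]
    exact Fintype.card_congr (Equiv.refl _)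

theorem charpoly_Delta {V : Type} [Fintype V] [DecidableEq V] (G : SimpleGraph V)
    [DecidableRel G.Adj] : (Delta G).charpoly = (G.adjMatrix ℂ).charpoly := by
  rw [← Matrix.charpoly_toLin']
  congr 1
  ext u p
  simp [Delta, SimpleGraph.adjMatrix_mulVec_apply]

theorem charpoly_Delta_gam_zero : (Delta (Gam 0)).charpoly = (X - 3) * (X + 1) ^ 3 := by
  have h : ((⊤ : SimpleGraph (Fin 4)).adjMatrix ℂ).charpoly = (X - 3) * (X + 1) ^ 3 := by
    rw [Matrix.charpoly, Matrix.charmatrix]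
    simp [Matrix.det_succ_row_zero, Fin.sum_univ_succ, Fin.succAbove]
    ring
  have hD : ∀ (i : Fintype (Fin 4)) (j : DecidableRel (⊤ : SimpleGraph (Fin 4)).Adj),
      (Delta (⊤ : SimpleGraph (Fin 4))).charpoly = (X - 3) * (X + 1) ^ 3 := fun i j => by
    obtain rfl := Subsingleton.elim i (Fin.fintype 4)
    rw [charpoly_Delta, ← h]
    congr!
  exact hD _ _

theorem charpoly_Delta_hat {V : Type} [Fintype V] (G : SimpleGraph V) [DecidableRel G.Adj]
    [Fintype G.Dart] [DecidableRel (hat G).Adj] (hG : G.IsRegularOfDegree 3) {k : ℕ}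
    (hk : Fintype.card V = 2 * k) :
    (Delta (hat G)).charpoly = (X * (X + 2)) ^ k * (Delta G).charpoly.comp f := by
  classical
  rw [charpoly_Delta, charpoly_Delta, charpoly_hat G hG hk]

theorem charpoly_Delta_gam_succ (n : ℕ) : (Delta (Gam (n + 1))).charpoly =
    (X * (X + 2)) ^ (2 * 3 ^ n) * (Delta (Gam n)).charpoly.comp f := by
  have hk : Fintype.card (Vert n) = 2 * (2 * 3 ^ n) := by rw [card_vert]; ring
  exact @charpoly_Delta_hat (Vert n) _ (Gam n) _ (instFintypeVert (n + 1))
    (instDecidableRelVertAdjGam (n + 1)) (isRegularOfDegree_gam n) _ hk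

theorem fIter_succ (p : ℕ) : (fIter p).comp f = fIter (p + 1) := by
  induction p with
  | zero => simp [fIter]
  | succ p ih =>
    have h : ∀ p, fIter (p + 1) = f.comp (fIter p) := fun p => Function.iterate_succ_apply' _ _ _
    rw [h p, comp_assoc, ih, ← h]

theorem charpoly_Delta_gam (n : ℕ) : (Delta (Gam n)).charpoly =
    (X - 3) * (X + 1) ^ 3 *
      ∏ p ∈ Finset.range n, ((fIter p - 2) ^ 3 * fIter p ^ (2 * 3 ^ (n - 1 - p)) *
        (fIter p + 2) ^ (1 + 2 * 3 ^ (n - 1 - p))) := by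
  induction n with
  | zero => simpa using charpoly_Delta_gam_zero
  | succ n ih =>
    rw [charpoly_Delta_gam_succ, ih, Finset.prod_range_succ', mul_comp, prod_comp]
    have h1 : ∀ p ∈ Finset.range n,
        ((fIter p - 2) ^ 3 * fIter p ^ (2 * 3 ^ (n - 1 - p)) *
          (fIter p + 2) ^ (1 + 2 * 3 ^ (n - 1 - p))).comp f =
        (fIter (p + 1) - 2) ^ 3 * fIter (p + 1) ^ (2 * 3 ^ (n + 1 - 1 - (p + 1))) *
          (fIter (p + 1) + 2) ^ (1 + 2 * 3 ^ (n + 1 - 1 - (p + 1))) := by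
      intro p _
      have h2 : n + 1 - 1 - (p + 1) = n - 1 - p := by omega
      simp only [mul_comp, pow_comp, sub_comp, add_comp, fIter_succ, ofNat_comp, h2, Nat.cast_ofNat]
    rw [Finset.prod_congr rfl h1]
    -- Here `f - 3 = (X - 3)(X + 2)` and `f + 1 = (X - 2)(X + 1)`. The new factors, with the power
    -- of `X (X + 2)`, make up the term `p = 0`; composition with `f` shifts the other terms.
    have h3 : ((X - 3) * (X + 1) ^ 3 : ℂ[X]).comp f =
        (X - 3) * (X + 1) ^ 3 * ((X - 2) ^ 3 * (X + 2)) := by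
      simp only [mul_comp, pow_comp, sub_comp, add_comp, X_comp, ofNat_comp, one_comp, f,
        Nat.cast_ofNat]
      ring
    have h4 : fIter 0 = X := rfl
    rw [h3, h4, Nat.add_sub_cancel, Nat.sub_zero, mul_pow, pow_add]
    ring

/-! ### Self-similarity of Pascal's triangle modulo 2. -/

theorem odd_choose_iff (n k : ℕ) :
    Odd (n.choose k) ↔ Odd ((n % 2).choose (k % 2)) ∧ Odd ((n / 2).choose (k / 2)) := by
  have : Fact (Nat.Prime 2) := ⟨Nat.prime_two⟩
  have h := Choose.choose_modEq_choose_mod_mul_choose_div_nat (n := n) (k := k) (p := 2)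
  rw [← Nat.odd_mul, Nat.odd_iff, Nat.odd_iff, h]

theorem odd_choose_succ (n k : ℕ) :
    Odd ((n + 1).choose (k + 1)) ↔ ¬ (Odd (n.choose k) ↔ Odd (n.choose (k + 1))) := by
  rw [Nat.choose_succ_succ, Nat.odd_add, ← Nat.not_odd_iff_even]
  tauto

/-- By Lucas, the last binary digits `(0,0)`, `(1,0)`, `(1,1)` contribute the factor 1 and `(0,1)`
contributes 0. So each odd position has exactly three children. -/
theorem odd_choose_child (n k : ℕ) (a b : ℕ) (ha : a < 2) (hb : b ≤ a) :
    Odd ((2 * n + a).choose (2 * k + b)) ↔ Odd (n.choose k) := by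
  rw [odd_choose_iff, show (2 * n + a) / 2 = n by omega, show (2 * k + b) / 2 = k by omega,
    show (2 * n + a) % 2 = a by omega, show (2 * k + b) % 2 = b by omega]
  interval_cases a <;> interval_cases b <;> simp

/-- The three vertices of the triangle which replaces a vertex of Pascal's triangle: the top one,
the left one and the right one. -/
def triChild (p : TriVert) (i : Fin 3) : TriVert :=
  ⟨(2 * p.1.1 + ![0, 1, 1] i, 2 * p.1.2 + ![0, 0, 1] i), by
    rw [odd_choose_child] <;> fin_cases i <;> simp [p.2]⟩

/-- `TriSide i p q` says that `q` is the neighbour of `p` to which the `i`-th vertex of the triangle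
replacing `p` is turned. -/
def TriSide (i : Fin 3) (p q : TriVert) : Prop :=
  ![q.1.1 + 1 = p.1.1 ∧ (q.1.2 = p.1.2 ∨ q.1.2 + 1 = p.1.2),
    (q.1.1 = p.1.1 ∧ q.1.2 + 1 = p.1.2) ∨ (q.1.1 = p.1.1 + 1 ∧ q.1.2 = p.1.2),
    (q.1.1 = p.1.1 ∧ q.1.2 = p.1.2 + 1) ∨ (q.1.1 = p.1.1 + 1 ∧ q.1.2 = p.1.2 + 1)] i

theorem triVert_ext {p q : TriVert} (h : p.1.1 = q.1.1) (h' : p.1.2 = q.1.2) : p = q :=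
  Subtype.ext (Prod.ext h h')

theorem triVert_eq_iff {p q : TriVert} : p = q ↔ p.1.1 = q.1.1 ∧ p.1.2 = q.1.2 :=
  ⟨fun h => h ▸ ⟨rfl, rfl⟩, fun h => triVert_ext h.1 h.2⟩

theorem tri_adj_iff {p q : TriVert} : tri.Adj p q ↔ ∃ i, TriSide i p q := by
  simp only [tri, SimpleGraph.fromRel_adj, ne_eq, triVert_eq_iff, Fin.exists_fin_succ, TriSide]
  simp
  omega

theorem TriSide.index_unique {i j : Fin 3} {p q : TriVert} (h : TriSide i p q)
    (h' : TriSide j p q) : i = j := by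
  fin_cases i <;> fin_cases j <;> simp [TriSide] at h h' ⊢ <;> omega

/-- The two candidates on a given side form with `p` an instance of Pascal's rule, whose three terms
cannot all be odd. -/
theorem TriSide.right_unique {i : Fin 3} {p q r : TriVert} (h : TriSide i p q)
    (h' : TriSide i p r) : q = r := by
  obtain ⟨⟨n, k⟩, hp⟩ := p
  obtain ⟨⟨n', k'⟩, hq⟩ := q
  obtain ⟨⟨n'', k''⟩, hr⟩ := r
  have key : ∀ m l, Odd (m.choose l) → Odd (m.choose (l + 1)) →
      ¬ Odd ((m + 1).choose (l + 1)) := fun m l h1 h2 h3 =>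
    (odd_choose_succ m l).1 h3 (iff_of_true h1 h2)
  suffices n' = n'' ∧ k' = k'' from triVert_ext this.1 this.2
  dsimp only at hp hq hr
  fin_cases i <;> simp only [TriSide, Fin.zero_eta, Fin.mk_one, Fin.reduceFinMk,
    Matrix.cons_val] at h h'
  · obtain ⟨rfl, h⟩ := h
    obtain ⟨h1, h'⟩ := h'
    obtain rfl : n' = n'' := by omega
    rcases h with rfl | rfl <;> rcases h' with h' | h'
    · omega
    · subst h'; exact absurd hp (key _ _ hr hq)
    · subst h'; exact absurd hp (key _ _ hq hr)
    · omega
  · rcases h with ⟨rfl, rfl⟩ | ⟨rfl, rfl⟩ <;> rcases h' with ⟨h1, h2⟩ | ⟨h1, h2⟩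
    · omega
    · subst h1 h2; exact absurd hr (key _ _ hq hp)
    · subst h1 h2; exact absurd hq (key _ _ hr hp)
    · omega
  · rcases h with ⟨rfl, rfl⟩ | ⟨rfl, rfl⟩ <;> rcases h' with ⟨h1, h2⟩ | ⟨h1, h2⟩
    · omega
    · subst h1 h2; exact absurd hr (key _ _ hp hq)
    · subst h1 h2; exact absurd hq (key _ _ hp hr)
    · omega

/-- Parity in Pascal's rule again: as `p` is odd, one of the two candidates is odd. Only the apex
has no upper side. -/
theorem exists_triSide (i : Fin 3) (p : TriVert) (h : i = 0 → p ≠ apex) :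
    ∃ q, TriSide i p q := by
  obtain ⟨⟨n, k⟩, hp⟩ := p
  fin_cases i <;> simp only [TriSide, Fin.zero_eta, Fin.mk_one, Fin.reduceFinMk,
    Matrix.cons_val]
  · dsimp only at hp
    obtain _ | n := n
    · obtain _ | k := k
      · exact absurd rfl (h rfl)
      · simp at hp
    obtain _ | k := k
    · exact ⟨⟨(n, 0), by simp⟩, rfl, Or.inl rfl⟩
    · rw [odd_choose_succ] at hp
      by_cases h1 : Odd (n.choose k)
      · exact ⟨⟨(n, k), h1⟩, rfl, Or.inr rfl⟩
      · exact ⟨⟨(n, k + 1), by tauto⟩, rfl, Or.inl rfl⟩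
  · obtain _ | k := k
    · exact ⟨⟨(n + 1, 0), by simp⟩, Or.inr ⟨rfl, rfl⟩⟩
    · by_cases h1 : Odd (n.choose k)
      · exact ⟨⟨(n, k), h1⟩, Or.inl ⟨rfl, rfl⟩⟩
      · exact ⟨⟨(n + 1, k + 1), by rw [odd_choose_succ]; tauto⟩, Or.inr ⟨rfl, rfl⟩⟩
  · by_cases h1 : Odd (n.choose (k + 1))
    · exact ⟨⟨(n, k + 1), h1⟩, Or.inl ⟨rfl, rfl⟩⟩
    · exact ⟨⟨(n + 1, k + 1), by rw [odd_choose_succ]; tauto⟩, Or.inr ⟨rfl, rfl⟩⟩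

theorem not_triSide_zero_apex (q : TriVert) : ¬ TriSide 0 apex q := by
  simp [TriSide, apex]

theorem tri_adj_triChild {p q : TriVert} {i j : Fin 3} :
    tri.Adj (triChild p i) (triChild q j) ↔
      (p = q ∧ i ≠ j) ∨ (TriSide i p q ∧ TriSide j q p) := by
  rw [tri_adj_iff, triVert_eq_iff]
  simp only [Fin.exists_fin_succ, TriSide, triChild]
  fin_cases i <;> fin_cases j <;> simp <;> omega

theorem triChild_injective {p q : TriVert} {i j : Fin 3} (h : triChild p i = triChild q j) :
    p = q ∧ i = j := by
  rw [triVert_eq_iff] at h ⊢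
  fin_cases i <;> fin_cases j <;> simp [triChild] at h ⊢ <;> omega

theorem exists_triChild (x : TriVert) : ∃ p i, triChild p i = x := by
  obtain ⟨⟨n, k⟩, hx⟩ := x
  obtain ⟨h1, h2⟩ := (odd_choose_iff n k).1 hx
  rcases Nat.mod_two_eq_zero_or_one n with hn | hn <;>
    rcases Nat.mod_two_eq_zero_or_one k with hk | hk
  · exact ⟨⟨(n / 2, k / 2), h2⟩, 0,
      triVert_ext (by simp [triChild]; omega) (by simp [triChild]; omega)⟩
  · simp [hn, hk] at h1
  · exact ⟨⟨(n / 2, k / 2), h2⟩, 1,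
      triVert_ext (by simp [triChild]; omega) (by simp [triChild]; omega)⟩
  · exact ⟨⟨(n / 2, k / 2), h2⟩, 2,
      triVert_ext (by simp [triChild]; omega) (by simp [triChild]; omega)⟩

/-! ### The isomorphism of the Pascal graph with its `hat`. -/

/-- `PascalSide i p q` says that `q` is the neighbour of `p` to which the `i`-th vertex of the
triangle replacing `p` is turned. -/
def PascalSide (i : Fin 3) (p q : Bool × TriVert) : Prop :=
  (p.1 = q.1 ∧ TriSide i p.2 q.2) ∨ (p.1 ≠ q.1 ∧ i = 0 ∧ p.2 = apex ∧ q.2 = apex)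

/-- The vertices of the triangle which replaces a vertex of the Pascal graph. -/
def pascalChild (p : Bool × TriVert) (i : Fin 3) : Bool × TriVert := (p.1, triChild p.2 i)

theorem pascal_adj_iff {p q : Bool × TriVert} : pascal.Adj p q ↔ ∃ i, PascalSide i p q := by
  simp only [pascal, tri_adj_iff, PascalSide, exists_or, exists_and_left, exists_eq_left]

theorem PascalSide.index_unique {i j : Fin 3} {p q : Bool × TriVert} (h : PascalSide i p q)
    (h' : PascalSide j p q) : i = j := by
  rcases h with ⟨h1, h⟩ | ⟨h1, rfl, -⟩ <;> rcases h' with ⟨h2, h'⟩ | ⟨h2, rfl, -⟩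
  exacts [h.index_unique h', absurd h1 h2, absurd h2 h1, rfl]

theorem PascalSide.right_unique {i : Fin 3} {p q r : Bool × TriVert} (h : PascalSide i p q)
    (h' : PascalSide i p r) : q = r := by
  obtain ⟨b, p⟩ := p
  obtain ⟨b', q⟩ := q
  obtain ⟨b'', r⟩ := r
  simp only [PascalSide] at h h'
  rcases h with ⟨rfl, h⟩ | ⟨h1, rfl, rfl, rfl⟩ <;> rcases h' with ⟨rfl, h'⟩ | ⟨h2, h3, h4, h5⟩
  · rw [h.right_unique h']
  · subst h3 h4
    exact absurd h (not_triSide_zero_apex q)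
  · exact absurd h' (not_triSide_zero_apex r)
  · subst h5
    cases b <;> cases b' <;> cases b'' <;> simp_all

theorem exists_pascalSide (i : Fin 3) (p : Bool × TriVert) : ∃ q, PascalSide i p q := by
  obtain ⟨b, p⟩ := p
  by_cases h : i = 0 ∧ p = apex
  · exact ⟨(!b, apex), Or.inr ⟨by simp, h.1, h.2, rfl⟩⟩
  · obtain ⟨q, hq⟩ := exists_triSide i p fun hi hp => h ⟨hi, hp⟩
    exact ⟨(b, q), Or.inl ⟨rfl, hq⟩⟩

theorem triChild_eq_apex {p : TriVert} {i : Fin 3} :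
    triChild p i = apex ↔ p = apex ∧ i = 0 := by
  rw [triVert_eq_iff, triVert_eq_iff]
  fin_cases i <;> simp [triChild, apex]

theorem pascal_adj_pascalChild {p q : Bool × TriVert} {i j : Fin 3} :
    pascal.Adj (pascalChild p i) (pascalChild q j) ↔
      (p = q ∧ i ≠ j) ∨ (PascalSide i p q ∧ PascalSide j q p) := by
  obtain ⟨b, p⟩ := p
  obtain ⟨b', q⟩ := q
  simp only [pascal, pascalChild, tri_adj_triChild, triChild_eq_apex, PascalSide, Prod.mk.injEq]
  by_cases h : b = b'
  · simp [h]
  · simp [h, Ne.symm h]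
    tauto

/-- The vertex of the Pascal graph associated to a pair of neighbours. -/
noncomputable def pascalDart (d : pascal.Dart) : Bool × TriVert :=
  pascalChild d.fst (pascal_adj_iff.1 d.adj).choose

theorem pascalDart_eq {d : pascal.Dart} {i : Fin 3} (h : PascalSide i d.fst d.snd) :
    pascalDart d = pascalChild d.fst i := by
  rw [pascalDart, (pascal_adj_iff.1 d.adj).choose_spec.index_unique h]

theorem pascalChild_injective {p q : Bool × TriVert} {i j : Fin 3}
    (h : pascalChild p i = pascalChild q j) : p = q ∧ i = j := by
  have h1 := triChild_injective (congrArg Prod.snd h)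
  exact ⟨Prod.ext (congrArg (fun x : Bool × TriVert => x.1) h :) h1.1, h1.2⟩

theorem pascalDart_bijective : Function.Bijective pascalDart := by
  constructor
  · intro d e h
    obtain ⟨i, hi⟩ := pascal_adj_iff.1 d.adj
    obtain ⟨j, hj⟩ := pascal_adj_iff.1 e.adj
    rw [pascalDart_eq hi, pascalDart_eq hj] at h
    obtain ⟨h1, rfl⟩ := pascalChild_injective h
    rw [← h1] at hj
    exact SimpleGraph.Dart.ext _ _ (Prod.ext h1 (hi.right_unique hj))
  · rintro ⟨b, x⟩
    obtain ⟨p, i, rfl⟩ := exists_triChild x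
    obtain ⟨q, hq⟩ := exists_pascalSide i (b, p)
    exact ⟨⟨((b, p), q), pascal_adj_iff.2 ⟨i, hq⟩⟩, pascalDart_eq hq⟩

theorem pascalDart_adj {d e : pascal.Dart} :
    pascal.Adj (pascalDart d) (pascalDart e) ↔ (hat pascal).Adj d e := by
  obtain ⟨i, hi⟩ := pascal_adj_iff.1 d.adj
  obtain ⟨j, hj⟩ := pascal_adj_iff.1 e.adj
  rw [pascalDart_eq hi, pascalDart_eq hj, pascal_adj_pascalChild, or_comm]
  refine or_congr ⟨fun h => ?_, ?_⟩ (and_congr_right fun h => not_congr ⟨?_, ?_⟩)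
  · exact SimpleGraph.Dart.ext _ _ (Prod.ext (hi.right_unique h.1).symm (hj.right_unique h.2))
  · rintro rfl
    exact ⟨hi, hj⟩
  · rintro rfl
    rw [← h] at hj
    exact SimpleGraph.Dart.ext _ _ (Prod.ext h (hi.right_unique hj))
  · rintro rfl
    exact hi.index_unique hj

/-- The Pascal graph is isomorphic to the graph obtained by replacing its vertices by triangles. -/
noncomputable def pascalIso : pascal ≃g hat pascal :=
  SimpleGraph.Iso.symm
    { toEquiv := Equiv.ofBijective pascalDart pascalDart_bijective
      map_rel_iff' := pascalDart_adj }

theorem pascalIso_eq_iff {x : Bool × TriVert} {d : pascal.Dart} :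
    pascalIso x = d ↔ pascalDart d = x :=
  (Equiv.ofBijective pascalDart pascalDart_bijective).symm_apply_eq.trans eq_comm

theorem threeNbrs_pascal : ThreeNbrs pascal := by
  intro p q r
  choose nb hnb using fun i => exists_pascalSide i p
  have h : ∀ i, pascal.Adj p (nb i) := fun i => pascal_adj_iff.2 ⟨i, hnb i⟩
  have hinj : Function.Injective nb := fun i j hij =>
    (hnb i).index_unique (hij ▸ hnb j)
  have h01 : nb 0 ≠ nb 1 := hinj.ne (by decide)
  have h02 : nb 0 ≠ nb 2 := hinj.ne (by decide)
  have h12 : nb 1 ≠ nb 2 := hinj.ne (by decide)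
  grind

/-! ### Rows, and the neighbourhoods of the apexes. -/

/-- The row of a vertex of the Pascal graph. -/
def row (x : Bool × TriVert) : ℕ := x.2.1.1

theorem PascalSide.row_le {i : Fin 3} {p q : Bool × TriVert} (h : PascalSide i p q) :
    row q ≤ row p + ![0, 1, 1] i := by
  rcases h with ⟨-, h⟩ | ⟨-, rfl, h1, h2⟩
  · fin_cases i <;> simp [TriSide, row] at h ⊢ <;> omega
  · simp [row, h1, h2]

/-- Passing to the parent halves the row, and the end of the dart is at most one row below its
origin. All inductions on rows rest on this. The bound 2 is needed: `(b, leftNb)` is the end of its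
own dart. -/
theorem row_pascalIso_lt {x : Bool × TriVert} (hx : 2 ≤ row x) :
    row (pascalIso x).fst < row x ∧ row (pascalIso x).snd < row x := by
  generalize hd : pascalIso x = d
  rw [pascalIso_eq_iff] at hd
  obtain ⟨i, hi⟩ := pascal_adj_iff.1 d.adj
  have h1 := hi.row_le
  have h2 : row (pascalDart d) = 2 * row d.fst + ![0, 1, 1] i := by rw [pascalDart_eq hi]; rfl
  rw [hd] at h2
  have h3 : ![0, 1, 1] i ≤ 1 := by fin_cases i <;> simp
  omega

theorem eq_of_row_lt_two {x : Bool × TriVert} (hx : row x < 2) :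
    x = (x.1, apex) ∨ x = (x.1, leftNb) ∨ x = (x.1, rightNb) := by
  obtain ⟨b, ⟨⟨n, k⟩, h⟩⟩ := x
  change n < 2 at hx
  dsimp only at h
  have hk : k ≤ n := by
    by_contra hc
    rw [Nat.choose_eq_zero_of_lt (by omega)] at h
    simp at h
  have h3 : (n = 0 ∧ k = 0) ∨ (n = 1 ∧ k = 0) ∨ (n = 1 ∧ k = 1) := by omega
  exact h3.imp (fun h => Prod.ext rfl (triVert_ext h.1 h.2)) (Or.imp
    (fun h => Prod.ext rfl (triVert_ext h.1 h.2)) (fun h => Prod.ext rfl (triVert_ext h.1 h.2)))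

theorem pascal_adj_apex (b : Bool) : pascal.Adj (b, apex) (!b, apex) :=
  Or.inr ⟨by simp, rfl, rfl⟩

theorem pascalSide_left (b : Bool) : PascalSide 1 (b, apex) (b, leftNb) :=
  Or.inl ⟨rfl, by simp [TriSide, apex, leftNb]⟩

theorem pascalSide_right (b : Bool) : PascalSide 2 (b, apex) (b, rightNb) :=
  Or.inl ⟨rfl, by simp [TriSide, apex, rightNb]⟩

theorem pascal_adj_left (b : Bool) : pascal.Adj (b, apex) (b, leftNb) :=
  pascal_adj_iff.2 ⟨_, pascalSide_left b⟩

theorem pascal_adj_right (b : Bool) : pascal.Adj (b, apex) (b, rightNb) :=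
  pascal_adj_iff.2 ⟨_, pascalSide_right b⟩

/-- With the next two lemmas: `x ↦ (pascalIso x).snd` exchanges the apexes and fixes their left and
right neighbours. -/
theorem pascalIso_apex (b : Bool) :
    pascalIso (b, apex) = ⟨((b, apex), (!b, apex)), pascal_adj_apex b⟩ := by
  rw [pascalIso_eq_iff, pascalDart_eq (i := 0) (Or.inr ⟨by simp, rfl, rfl, rfl⟩)]
  exact Prod.ext rfl (triVert_ext rfl rfl)

theorem pascalIso_left (b : Bool) :
    pascalIso (b, leftNb) = ⟨((b, apex), (b, leftNb)), pascal_adj_left b⟩ := by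
  rw [pascalIso_eq_iff, pascalDart_eq (pascalSide_left b)]
  exact Prod.ext rfl (triVert_ext rfl rfl)

theorem pascalIso_right (b : Bool) :
    pascalIso (b, rightNb) = ⟨((b, apex), (b, rightNb)), pascal_adj_right b⟩ := by
  rw [pascalIso_eq_iff, pascalDart_eq (pascalSide_right b)]
  exact Prod.ext rfl (triVert_ext rfl rfl)

theorem neighborSet_apex (b : Bool) :
    pascal.neighborSet (b, apex) = {(!b, apex), (b, leftNb), (b, rightNb)} := by
  ext x
  rw [SimpleGraph.mem_neighborSet, pascal_adj_iff, Fin.exists_fin_succ, Fin.exists_fin_two]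
  refine or_congr ⟨fun h => h.right_unique ?_, ?_⟩ (or_congr ⟨fun h => h.right_unique
    (pascalSide_left b), ?_⟩ ⟨fun h => h.right_unique (pascalSide_right b), ?_⟩)
  · exact Or.inr ⟨by simp, rfl, rfl, rfl⟩
  · rintro rfl
    exact Or.inr ⟨by simp, rfl, rfl, rfl⟩
  · rintro rfl
    exact pascalSide_left b
  · rintro rfl
    exact pascalSide_right b

/-! ### Coverings of `Γ_0` by the Pascal graph: uniqueness. -/

/-- Pulling back coverings of graphs along the isomorphism `pascalIso`. -/
noncomputable def pullPascal {W : Type} {H : SimpleGraph W} (w : Covering (hat pascal) H) :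
    Covering pascal H :=
  ⟨w.1 ∘ pascalIso, w.2.comp (isCovering_iso pascalIso)⟩

theorem pullPascal_bijective {W : Type} {H : SimpleGraph W} :
    Function.Bijective (pullPascal : Covering (hat pascal) H → _) := by
  refine ⟨fun w w' h => Subtype.ext (funext fun d => ?_), fun w =>
    ⟨⟨w.1 ∘ pascalIso.symm, w.2.comp (isCovering_iso pascalIso.symm)⟩,
      Subtype.ext (funext fun x => congrArg w.1 (pascalIso.symm_apply_apply x))⟩⟩
  obtain ⟨x, rfl⟩ := pascalIso.surjective d
  exact congrFun (congrArg Subtype.val h) x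

/-- The map `Cov(Γ, Γ_n) → Cov(Γ, Γ_{n+1})`. -/
noncomputable def liftPascal {n : ℕ} (w : Covering pascal (Gam n)) :
    Covering pascal (Gam (n + 1)) := pullPascal (hatGam w)

/-- The map `Cov(Γ, Γ_0) → Cov(Γ, Γ_0)` induced by the covering `Γ → Γ`. -/
noncomputable def shiftPascal (w : Covering pascal (Gam 0)) : Covering pascal (Gam 0) :=
  pullPascal (sndGam w)

theorem liftPascal_bijective (n : ℕ) :
    Function.Bijective (liftPascal : Covering pascal (Gam n) → _) :=
  pullPascal_bijective.comp (hatGam_bijective threeNbrs_pascal n)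

theorem shiftPascal_bijective : Function.Bijective shiftPascal :=
  pullPascal_bijective.comp (sndGam_bijective threeNbrs_pascal)

theorem shiftPascal_apply (w : Covering pascal (Gam 0)) (x : Bool × TriVert) :
    (shiftPascal w).1 x = w.1 (pascalIso x).snd := rfl

theorem row_apex (b : Bool) : row (b, apex) < 2 := by simp [row, apex]

theorem row_left (b : Bool) : row (b, leftNb) < 2 := by simp [row, leftNb]

theorem row_right (b : Bool) : row (b, rightNb) < 2 := by simp [row, rightNb]

/-- A covering `Γ → Γ_0` is determined by its values on the first two rows. -/
theorem covering_pascal_ext {w w' : Covering pascal (Gam 0)}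
    (h : ∀ x, row x < 2 → w.1 x = w'.1 x) : w = w' := by
  refine Subtype.ext (funext fun x => ?_)
  induction hn : row x using Nat.strong_induction_on generalizing w w' x with
  | _ n ih =>
  subst hn
  by_cases hx : row x < 2
  · exact h x hx
  -- The values at `x` are those of the unshifted coverings at a vertex of smaller row. These still
  -- agree on the first two rows, which the shift only permutes.
  obtain ⟨c, rfl⟩ := shiftPascal_bijective.2 w
  obtain ⟨c', rfl⟩ := shiftPascal_bijective.2 w'
  refine ih _ (row_pascalIso_lt (not_lt.1 hx)).2 (fun y hy => ?_) (pascalIso x).snd rfl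
  simp only [shiftPascal_apply] at h
  rcases eq_of_row_lt_two hy with h1 | h1 | h1 <;> rw [h1]
  · simpa [pascalIso_apex] using h (!y.1, apex) (row_apex _)
  · simpa [pascalIso_left] using h (y.1, leftNb) (row_left _)
  · simpa [pascalIso_right] using h (y.1, rightNb) (row_right _)

/-- The values of a covering `Γ → Γ_0` at an apex and its neighbours are distinct. -/
theorem covering_pascal_apex (w : Covering pascal (Gam 0)) (b : Bool) :
    w.1 (b, apex) ≠ w.1 (!b, apex) ∧ w.1 (b, apex) ≠ w.1 (b, leftNb) ∧
      w.1 (b, apex) ≠ w.1 (b, rightNb) ∧ w.1 (!b, apex) ≠ w.1 (b, leftNb) ∧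
      w.1 (!b, apex) ≠ w.1 (b, rightNb) ∧ w.1 (b, leftNb) ≠ w.1 (b, rightNb) := by
  have hinj := (w.2 (b, apex)).injOn
  have hlr : (b, leftNb) ≠ (b, rightNb) := fun h =>
    absurd (congrArg (fun x : Bool × TriVert => x.2.1.2) h) (by simp [leftNb, rightNb])
  have hb : ∀ y, (!b, apex) ≠ (b, y) := fun y h =>
    absurd (congrArg (fun x : Bool × TriVert => x.1) h) (by simp)
  exact ⟨w.2.adj (pascal_adj_apex b), w.2.adj (pascal_adj_left b), w.2.adj (pascal_adj_right b),
    hinj.ne (pascal_adj_apex b) (pascal_adj_left b) (hb _),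
    hinj.ne (pascal_adj_apex b) (pascal_adj_right b) (hb _),
    hinj.ne (pascal_adj_left b) (pascal_adj_right b) hlr⟩

/-- The second triangle is coloured near the apex as the first one or as its mirror image. -/
theorem covering_pascal_cases (w : Covering pascal (Gam 0)) :
    (w.1 (false, leftNb) = w.1 (true, leftNb) ∧ w.1 (false, rightNb) = w.1 (true, rightNb)) ∨
      (w.1 (false, leftNb) = w.1 (true, rightNb) ∧
        w.1 (false, rightNb) = w.1 (true, leftNb)) := by
  -- Both pairs of side neighbours carry the two colours not used at the apexes.
  have key : ∀ a a' b b' c c' : Fin 4, a ≠ a' ∧ a ≠ b ∧ a ≠ c ∧ a' ≠ b ∧ a' ≠ c ∧ b ≠ c →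
      a' ≠ a ∧ a' ≠ b' ∧ a' ≠ c' ∧ a ≠ b' ∧ a ≠ c' ∧ b' ≠ c' →
      (b = b' ∧ c = c') ∨ (b = c' ∧ c = b') := by omega
  exact key _ _ _ _ _ _ (covering_pascal_apex w false) (covering_pascal_apex w true)

/-- The first apex, its neighbours in its triangle and the second apex. -/
def apexNbhd : Fin 4 → Bool × TriVert :=
  ![(false, apex), (false, leftNb), (false, rightNb), (true, apex)]

theorem apexNbhd_bijective (w : Covering pascal (Gam 0)) :
    Function.Bijective (fun i => w.1 (apexNbhd i) : Fin 4 → Fin 4) := by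
  refine Finite.injective_iff_bijective.1 fun i j h => ?_
  have h1 := covering_pascal_apex w false
  simp only [Bool.not_false] at h1
  fin_cases i <;> fin_cases j <;> simp [apexNbhd] at h ⊢ <;> simp_all

/-- Matching the four colours around the first apex determines the permutation; the hypothesis then
settles the two remaining vertices of the first two rows. -/
theorem exists_smul_eq {w w' : Covering pascal (Gam 0)}
    (h : w.1 (false, leftNb) = w.1 (true, leftNb) ↔
      w'.1 (false, leftNb) = w'.1 (true, leftNb)) :
    ∃ s : Equiv.Perm (Fin 4), s • w = w' := by
  let E : Covering pascal (Gam 0) → Equiv.Perm (Fin 4) := fun w =>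
    Equiv.ofBijective _ (apexNbhd_bijective w)
  refine ⟨(E w).symm.trans (E w'), ?_⟩
  have key : ∀ i, (((E w).symm.trans (E w')) • w).1 (apexNbhd i) = w'.1 (apexNbhd i) := fun i =>
    congrArg (E w') ((E w).symm_apply_apply i)
  generalize (E w).symm.trans (E w') = s at *
  have h0 := key 0
  have h1 := key 1
  have h2 := key 2
  have h3 := key 3
  simp only [apexNbhd, Matrix.cons_val] at h0 h1 h2 h3
  have hs : (s • w).1 (false, leftNb) = (s • w).1 (true, leftNb) ↔
      w'.1 (false, leftNb) = w'.1 (true, leftNb) := by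
    rw [← h]
    exact s.injective.eq_iff
  have hc := covering_pascal_cases (s • w)
  have hc' := covering_pascal_cases w'
  have ha := (covering_pascal_apex w' true).2.2.2.2.2
  generalize s • w = v at *
  have h4 : v.1 (true, leftNb) = w'.1 (true, leftNb) ∧
      v.1 (true, rightNb) = w'.1 (true, rightNb) := by
    grind
  refine covering_pascal_ext fun x hx => ?_
  rcases eq_of_row_lt_two hx with h5 | h5 | h5 <;> rw [h5] <;> cases x.1
  exacts [h0, h3, h1, h4.1, h2, h4.2]

/-! ### Coverings of `Γ_0` by the Pascal graph: existence. -/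

/-- The colouring of the first two rows which serves to construct coverings `Γ → Γ_0`. -/
noncomputable def initColour (i j : Fin 4) (x : Bool × TriVert) : Fin 4 :=
  open Classical in
  if x.2 = apex then bif x.1 then 3 else 0
  else if x.2 = leftNb then bif x.1 then i else 1
  else bif x.1 then j else 2

/-- The transformation of colourings of the Pascal graph of which we construct a fixed point. -/
noncomputable def shiftColour (c : Bool × TriVert → Fin 4) (x : Bool × TriVert) : Fin 4 :=
  Equiv.swap 0 3 (c (pascalIso x).snd)

theorem leftNb_ne_apex : leftNb ≠ apex := fun h => by
  have := (triVert_eq_iff.1 h).1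
  simp [leftNb, apex] at this

theorem rightNb_ne_apex : rightNb ≠ apex := fun h => by
  have := (triVert_eq_iff.1 h).1
  simp [rightNb, apex] at this

theorem rightNb_ne_leftNb : rightNb ≠ leftNb := fun h => by
  have := (triVert_eq_iff.1 h).2
  simp [rightNb, leftNb] at this

theorem initColour_apex (i j : Fin 4) (b : Bool) :
    initColour i j (b, apex) = bif b then 3 else 0 := by
  simp [initColour]

theorem initColour_left (i j : Fin 4) (b : Bool) :
    initColour i j (b, leftNb) = bif b then i else 1 := by
  simp [initColour, leftNb_ne_apex]

theorem initColour_right (i j : Fin 4) (b : Bool) :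
    initColour i j (b, rightNb) = bif b then j else 2 := by
  simp [initColour, rightNb_ne_apex, rightNb_ne_leftNb]

section

variable {i j : Fin 4}

/-- A colouring which has the prescribed values on the first two rows. -/
def IsInit (i j : Fin 4) (c : Bool × TriVert → Fin 4) : Prop :=
  ∀ x, row x < 2 → c x = initColour i j x

/-- The shift exchanges the apexes, coloured 0 and 3; the transposition undoes this and fixes the
colours 1 and 2 of the other neighbours. -/
theorem IsInit.shift (hij : (i = 1 ∧ j = 2) ∨ (i = 2 ∧ j = 1)) {c : Bool × TriVert → Fin 4}
    (hc : IsInit i j c) :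
    IsInit i j (shiftColour c) := by
  intro x hx
  rw [shiftColour]
  rcases eq_of_row_lt_two hx with h | h | h <;> rw [h] <;> generalize x.1 = b
  · rw [pascalIso_apex, initColour_apex]
    change Equiv.swap 0 3 (c (!b, apex)) = _
    rw [hc _ (row_apex _), initColour_apex]
    cases b <;> decide
  · rw [pascalIso_left, initColour_left]
    change Equiv.swap 0 3 (c (b, leftNb)) = _
    rw [hc _ (row_left _), initColour_left]
    rcases hij with ⟨rfl, rfl⟩ | ⟨rfl, rfl⟩ <;> cases b <;> decide
  · rw [pascalIso_right, initColour_right]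
    change Equiv.swap 0 3 (c (b, rightNb)) = _
    rw [hc _ (row_right _), initColour_right]
    rcases hij with ⟨rfl, rfl⟩ | ⟨rfl, rfl⟩ <;> cases b <;> decide

/-- A fixed point of `shiftColour`. -/
noncomputable def limitColour (i j : Fin 4) (x : Bool × TriVert) : Fin 4 :=
  shiftColour^[row x] (initColour i j) x

theorem isInit_iterate (hij : (i = 1 ∧ j = 2) ∨ (i = 2 ∧ j = 1))
    (n : ℕ) : IsInit i j (shiftColour^[n] (initColour i j)) := by
  induction n with
  | zero => exact fun _ _ => rfl
  | succ n ih => rw [Function.iterate_succ_apply']; exact IsInit.shift hij ih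

/-- From row 2 on, a shifted colouring at `x` reads the old one in a smaller row, so the value at
`x` is final after `row x` iterations. -/
theorem shiftColour_iterate_stable (hij : (i = 1 ∧ j = 2) ∨ (i = 2 ∧ j = 1))
    (n : ℕ) : ∀ x, row x ≤ n →
    shiftColour^[n] (initColour i j) x = limitColour i j x := by
  have h : ∀ n x, row x ≤ n → shiftColour^[n + 1] (initColour i j) x =
      shiftColour^[n] (initColour i j) x := by
    intro n
    induction n with
    | zero =>
      intro x hx
      rw [isInit_iterate hij _ x (by omega), isInit_iterate hij _ x (by omega)]
    | succ n ih =>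
      intro x hx
      by_cases hx2 : row x < 2
      · rw [isInit_iterate hij _ x hx2, isInit_iterate hij _ x hx2]
      · have h1 := (row_pascalIso_lt (not_lt.1 hx2)).2
        have h2 := congrArg (Equiv.swap 0 3) (ih _ (show row (pascalIso x).snd ≤ n by omega))
        rw [Function.iterate_succ_apply'] at h2
        rwa [Function.iterate_succ_apply', Function.iterate_succ_apply']
  intro x hx
  induction n, hx using Nat.le_induction with
  | base => rfl
  | succ n hn ih => rw [h n x hn, ih]

theorem shiftColour_limitColour (hij : (i = 1 ∧ j = 2) ∨ (i = 2 ∧ j = 1)) :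
    shiftColour (limitColour i j) = limitColour i j := by
  funext x
  set n := row x + row (pascalIso x).snd
  rw [← shiftColour_iterate_stable hij (n + 1) x (by omega), Function.iterate_succ_apply',
    shiftColour, shiftColour, shiftColour_iterate_stable hij n _ (by omega)]

theorem isInit_limitColour (hij : (i = 1 ∧ j = 2) ∨ (i = 2 ∧ j = 1)) :
    IsInit i j (limitColour i j) :=
  fun x hx => isInit_iterate hij _ x hx

theorem bijOn_limitColour_apex (hij : (i = 1 ∧ j = 2) ∨ (i = 2 ∧ j = 1)) (b : Bool) :
    Set.BijOn (limitColour i j) (pascal.neighborSet (b, apex))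
      ((⊤ : SimpleGraph (Fin 4)).neighborSet (limitColour i j (b, apex))) := by
  have h := isInit_limitColour hij
  have h1 := fun b => (h _ (row_apex b)).trans (initColour_apex i j b)
  have h2 := fun b => (h _ (row_left b)).trans (initColour_left i j b)
  have h3 := fun b => (h _ (row_right b)).trans (initColour_right i j b)
  rw [neighborSet_apex]
  generalize limitColour i j = c at *
  refine ⟨?_, ?_, ?_⟩
  · rintro x (rfl | rfl | rfl) <;> rw [SimpleGraph.mem_neighborSet, SimpleGraph.top_adj] <;>
      simp only [h1, h2, h3] <;>
      rcases hij with ⟨rfl, rfl⟩ | ⟨rfl, rfl⟩ <;> cases b <;> decide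
  · rintro x (rfl | rfl | rfl) y (rfl | rfl | rfl) hxy <;> first | rfl | (
      exfalso
      simp only [h1, h2, h3] at hxy
      revert hxy
      rcases hij with ⟨rfl, rfl⟩ | ⟨rfl, rfl⟩ <;> cases b <;> decide)
  · intro t ht
    rw [SimpleGraph.mem_neighborSet, SimpleGraph.top_adj, h1] at ht
    rw [Set.image_insert_eq, Set.image_pair, h1, h2, h3]
    simp only [Set.mem_insert_iff, Set.mem_singleton_iff]
    rcases hij with ⟨rfl, rfl⟩ | ⟨rfl, rfl⟩ <;> revert b t <;> decide

/-- The covering condition passes from a vertex to the darts issuing from it by `snd_bijOn`; the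
fixed point equation says that the resulting colouring is the same one. -/
theorem bijOn_limitColour_of_fst (hij : (i = 1 ∧ j = 2) ∨ (i = 2 ∧ j = 1))
    {x : Bool × TriVert}
    (h : Set.BijOn (limitColour i j) (pascal.neighborSet (pascalIso x).fst)
      ((⊤ : SimpleGraph (Fin 4)).neighborSet (limitColour i j (pascalIso x).fst))) :
    Set.BijOn (limitColour i j) (pascal.neighborSet x)
      ((⊤ : SimpleGraph (Fin 4)).neighborSet (limitColour i j x)) := by
  have h1 := (snd_bijOn (pascalIso x).adj h).comp (isCovering_iso pascalIso x)
  have h2 : IsCovering (⊤ : SimpleGraph (Fin 4)) (⊤ : SimpleGraph (Fin 4)) (Equiv.swap 0 3) :=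
    isCovering_iso (permAut 0 (Equiv.swap 0 3))
  have h3 := (h2 _).comp h1
  have h4 := shiftColour_limitColour hij
  rw [← h4]
  exact h3

theorem isCovering_limitColour (hij : (i = 1 ∧ j = 2) ∨ (i = 2 ∧ j = 1)) :
    IsCovering pascal (⊤ : SimpleGraph (Fin 4)) (limitColour i j) := by
  intro x
  induction hn : row x using Nat.strong_induction_on generalizing x with
  | _ n ih =>
  subst hn
  by_cases hx : row x < 2
  -- The vertices of the first two rows correspond to darts issuing from an apex.
  · refine bijOn_limitColour_of_fst hij ?_
    have h : (pascalIso x).fst = (x.1, apex) := by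
      rcases eq_of_row_lt_two hx with h | h | h
      · rw [h, pascalIso_apex]
      · rw [h, pascalIso_left]
      · rw [h, pascalIso_right]
    rw [h]
    exact bijOn_limitColour_apex hij x.1
  · exact bijOn_limitColour_of_fst hij (ih _ (row_pascalIso_lt (not_lt.1 hx)).1 _ rfl)

end

theorem exists_covering_left : ∃ w : Covering pascal (Gam 0),
    w.1 (false, leftNb) = w.1 (true, leftNb) := by
  have hij : ((1 : Fin 4) = 1 ∧ (2 : Fin 4) = 2) ∨ ((1 : Fin 4) = 2 ∧ (2 : Fin 4) = 1) := by decide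
  refine ⟨⟨limitColour 1 2, isCovering_limitColour hij⟩, ?_⟩
  exact (isInit_limitColour hij _ (row_left _)).trans ((initColour_left _ _ _).trans
    ((isInit_limitColour hij _ (row_left _)).trans (initColour_left _ _ true)).symm)

theorem exists_covering_right : ∃ w : Covering pascal (Gam 0),
    w.1 (false, leftNb) = w.1 (true, rightNb) := by
  have hij : ((2 : Fin 4) = 1 ∧ (1 : Fin 4) = 2) ∨ ((2 : Fin 4) = 2 ∧ (1 : Fin 4) = 1) := by decide
  refine ⟨⟨limitColour 2 1, isCovering_limitColour hij⟩, ?_⟩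
  exact (isInit_limitColour hij _ (row_left _)).trans ((initColour_left _ _ _).trans
    ((isInit_limitColour hij _ (row_right _)).trans (initColour_right _ _ true)).symm)

/-! ### Reduction to `n = 0` and the two orbits; part (ii). -/

/-- The covering `Γ_n → Γ_0` which maps an edge to the image of its end point. -/
def sndIter : (n : ℕ) → Covering (Gam n) (Gam 0)
  | 0 => ⟨id, isCovering_iso SimpleGraph.Iso.refl⟩
  | n + 1 => sndGam (sndIter n)

theorem sndIter_smul (n : ℕ) (s : Equiv.Perm (Fin 4)) (p : Vert n) :
    (sndIter n).1 (permAut n s p) = s ((sndIter n).1 p) := by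
  induction n with
  | zero => rfl
  | succ n ih => exact ih _

/-- The map `Cov(Γ, Γ_n) → Cov(Γ, Γ_0)` given by composition with `sndIter n`. -/
def compSndIter {n : ℕ} (w : Covering pascal (Gam n)) : Covering pascal (Gam 0) :=
  ⟨(sndIter n).1 ∘ w.1, (sndIter n).2.comp w.2⟩

theorem compSndIter_smul {n : ℕ} (s : Equiv.Perm (Fin 4)) (w : Covering pascal (Gam n)) :
    compSndIter (s • w) = s • compSndIter w :=
  Subtype.ext (funext fun x => sndIter_smul n s (w.1 x))

/-- Taking the end of a dart commutes with the map induced on darts, so `compSndIter` after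
`liftPascal` is `shiftPascal` after `compSndIter`. -/
theorem compSndIter_bijective : ∀ n : ℕ,
    Function.Bijective (compSndIter : Covering pascal (Gam n) → _)
  | 0 => Function.bijective_id
  | n + 1 => by
    refine (Function.Bijective.of_comp_iff _ (liftPascal_bijective n)).1 ?_
    exact shiftPascal_bijective.comp (compSndIter_bijective n)

/-- By (i), `κ` differs from `sndIter n` by a permutation of the colours, which does not affect
equalities. -/
theorem mem_agreeSet_iff {n : ℕ} (κ : Covering (Gam n) (Gam 0)) (x : TriVert)
    (w : Covering pascal (Gam n)) : w ∈ agreeSet n κ x ↔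
      (compSndIter w).1 (false, leftNb) = (compSndIter w).1 (true, x) := by
  obtain ⟨s, rfl, -⟩ := (simplyTransitive_gam 0 n n.zero_le).2 (sndIter n) κ
  exact s.injective.eq_iff

theorem eq_one_of_smul_eq {w : Covering pascal (Gam 0)} {s : Equiv.Perm (Fin 4)}
    (h : s • w = w) : s = 1 := by
  refine Equiv.ext fun t => ?_
  obtain ⟨i, rfl⟩ := (apexNbhd_bijective w).2 t
  exact congrFun (congrArg Subtype.val h) (apexNbhd i)

theorem left_iff_not_right (w : Covering pascal (Gam 0)) :
    w.1 (false, leftNb) = w.1 (true, leftNb) ↔ ¬ w.1 (false, leftNb) = w.1 (true, rightNb) := by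
  have h1 := covering_pascal_cases w
  have h2 := (covering_pascal_apex w true).2.2.2.2.2
  grind

theorem orbit_eq_iff {n : ℕ} {w w' : Covering pascal (Gam n)} :
    w' ∈ MulAction.orbit (Equiv.Perm (Fin 4)) w ↔
      ((compSndIter w).1 (false, leftNb) = (compSndIter w).1 (true, leftNb) ↔
        (compSndIter w').1 (false, leftNb) = (compSndIter w').1 (true, leftNb)) := by
  constructor
  · rintro ⟨s, rfl⟩
    change _ ↔ (compSndIter (s • w)).1 _ = (compSndIter (s • w)).1 _
    rw [compSndIter_smul]
    exact s.injective.eq_iff.symm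
  · intro h
    obtain ⟨s, hs⟩ := exists_smul_eq h
    exact ⟨s, (compSndIter_bijective n).1 ((compSndIter_smul s w).trans hs)⟩

theorem orbit_eq_agreeSet {n : ℕ} (κ : Covering (Gam n) (Gam 0)) (w : Covering pascal (Gam n)) :
    (w ∈ agreeSet n κ leftNb →
      MulAction.orbit (Equiv.Perm (Fin 4)) w = agreeSet n κ leftNb) ∧
    (w ∈ agreeSet n κ rightNb →
      MulAction.orbit (Equiv.Perm (Fin 4)) w = agreeSet n κ rightNb) := by
  simp only [Set.ext_iff, orbit_eq_iff, mem_agreeSet_iff]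
  refine ⟨fun h v => by simp only [h, true_iff], fun h v => ?_⟩
  rw [left_iff_not_right, left_iff_not_right (compSndIter v), not_iff_not]
  simp only [h, true_iff]

theorem exists_mem_agreeSet {n : ℕ} (κ : Covering (Gam n) (Gam 0)) :
    (∃ w, w ∈ agreeSet n κ leftNb) ∧ ∃ w, w ∈ agreeSet n κ rightNb := by
  simp only [mem_agreeSet_iff]
  constructor
  · obtain ⟨w, hw⟩ := exists_covering_left
    obtain ⟨w, rfl⟩ := (compSndIter_bijective n).2 w
    exact ⟨w, hw⟩
  · obtain ⟨w, hw⟩ := exists_covering_right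
    obtain ⟨w, rfl⟩ := (compSndIter_bijective n).2 w
    exact ⟨w, hw⟩

theorem range_orbit {n : ℕ} (κ : Covering (Gam n) (Gam 0)) :
    Set.range (fun w : Covering pascal (Gam n) => MulAction.orbit (Equiv.Perm (Fin 4)) w) =
      {agreeSet n κ leftNb, agreeSet n κ rightNb} := by
  obtain ⟨⟨w, hw⟩, w', hw'⟩ := exists_mem_agreeSet κ
  refine Set.Subset.antisymm ?_ ?_
  · rintro _ ⟨v, rfl⟩
    by_cases h : v ∈ agreeSet n κ leftNb
    · exact Or.inl ((orbit_eq_agreeSet κ v).1 h)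
    · refine Or.inr ((orbit_eq_agreeSet κ v).2 ?_)
      rw [mem_agreeSet_iff] at h ⊢
      rwa [left_iff_not_right, not_not] at h
  · rintro _ (rfl | rfl)
    exacts [⟨w, (orbit_eq_agreeSet κ w).1 hw⟩, ⟨w', (orbit_eq_agreeSet κ w').2 hw'⟩]

theorem agreeSet_ne {n : ℕ} (κ : Covering (Gam n) (Gam 0)) :
    agreeSet n κ leftNb ≠ agreeSet n κ rightNb := by
  obtain ⟨w, hw⟩ := (exists_mem_agreeSet κ).1
  intro h
  have hw' := h ▸ hw
  rw [mem_agreeSet_iff] at hw hw'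
  exact (left_iff_not_right _).1 hw hw'

end PascalGraph

theorem mainTheorem2 :
    (∀ n m : ℕ, n ≤ m →
      Nonempty (PascalGraph.Covering (PascalGraph.Gam m) (PascalGraph.Gam n)) ∧
      ∀ w w' : PascalGraph.Covering (PascalGraph.Gam m) (PascalGraph.Gam n),
        ∃! s : Equiv.Perm (Fin 4), s • w = w') ∧
    (∀ n : ℕ,
      Nonempty (PascalGraph.Covering PascalGraph.pascal (PascalGraph.Gam n)) ∧
      (∀ (w : PascalGraph.Covering PascalGraph.pascal (PascalGraph.Gam n))
        (s : Equiv.Perm (Fin 4)), s • w = w → s = 1) ∧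
      ∀ κ : PascalGraph.Covering (PascalGraph.Gam n) (PascalGraph.Gam 0),
        PascalGraph.agreeSet n κ PascalGraph.leftNb ≠
          PascalGraph.agreeSet n κ PascalGraph.rightNb ∧
        Set.range (fun w : PascalGraph.Covering PascalGraph.pascal (PascalGraph.Gam n) =>
            MulAction.orbit (Equiv.Perm (Fin 4)) w) =
          {PascalGraph.agreeSet n κ PascalGraph.leftNb,
            PascalGraph.agreeSet n κ PascalGraph.rightNb}) ∧
    (∀ n : ℕ,
      (PascalGraph.Delta (PascalGraph.Gam n)).charpoly =
        (Polynomial.X - 3) * (Polynomial.X + 1) ^ 3 *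
          ∏ p ∈ Finset.range n,
            ((PascalGraph.fIter p - 2) ^ 3 *
              PascalGraph.fIter p ^ (2 * 3 ^ (n - 1 - p)) *
              (PascalGraph.fIter p + 2) ^ (1 + 2 * 3 ^ (n - 1 - p)))) := by
  refine ⟨PascalGraph.simplyTransitive_gam, fun n => ?_, PascalGraph.charpoly_Delta_gam⟩
  obtain ⟨⟨κ⟩, -⟩ := PascalGraph.simplyTransitive_gam 0 n n.zero_le
  refine ⟨(PascalGraph.exists_mem_agreeSet κ).1.nonempty, fun w s h => ?_, fun κ =>
    ⟨PascalGraph.agreeSet_ne κ, PascalGraph.range_orbit κ⟩⟩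
  exact PascalGraph.eq_one_of_smul_eq
    ((PascalGraph.compSndIter_smul s w).symm.trans (congrArg PascalGraph.compSndIter h))
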